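/- Let $n\ge 1$ and let $u\colon\mathbb R^n\to(-\infty,\infty]$ be a proper, lower semicontinuous, convex function whose domain $\operatorname{dom}(u)=\{x: u(x)<\infty\}$ is compact and which satisfies $u\le 0$ on $\operatorname{dom}(u)$ (that is, $u\in\mathrm{Conv}_0$). Notation. $u^*(y)=\sup_{x\in\mathbb R^n}(\langle x,y\rangle-u(x))$ is the convex conjugate, $h_K(x)=\sup_{y\in K}\langle x,y\rangle$ the support function of a compact convex set $K$, and $$K^u=\{(x,t)\in\mathbb R^n\times\mathbb R: u(x)\le t \text{ and } u(x)\le -t\}\subset\mathbb R^{n+1}.$$ For a continuous $\varphi\colon\mathbb R^n\to\mathbb R$ the recession function is $\rho_\varphi(z)=\lim_{t\to\infty}\varphi(tz)/t$ for $|z|=1$ (if the limits exist), extended positively $1$-homogeneously to $\mathbb R^n$; $C_{\mathrm{rec}}(\mathbb R^n)$ is the set of all continuous $\varphi$ for which $\rho_\varphi$ exists, is finite and continuous, and $|\rho_\varphi-\varphi|$ is bounded on $\mathbb R^n$. For $\nu=(\nu',\nu_{n+1})\in\mathbb S^n$ with $\nu_{n+1}\ne 0$ put $g(\nu)=\nu'/|\nu_{n+1}|$.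 The spherical function $\tilde\varphi\colon\mathbb S^n\to\mathbb R$ associated with $\varphi\in C_{\mathrm{rec}}(\mathbb R^n)$ is $$\tilde\varphi(\nu)=\frac{\varphi(g(\nu))}{\sqrt{1+|g(\nu)|^2}}\ \text{ if }\nu_{n+1}\neq 0,\qquad \tilde\varphi(\nu)=\rho_\varphi(\nu')\ \text{ if }\nu_{n+1}=0 .$$ If $\operatorname{dom}(u)$ has dimension $n$, let $$Z_\varphi(u)=\int_{\operatorname{dom}(u)}\varphi(\nabla u(x))\,dx+\int_{\operatorname{bd}(\operatorname{dom}(u))}|u(x)|\,\rho_\varphi(\nu_{\operatorname{dom}(u)}(x))\,d\mathcal H^{n-1}(x),$$ where $\nu_{\operatorname{dom}(u)}(x)$ is the ($\mathcal H^{n-1}$-almost everywhere unique) outer unit normal of $\operatorname{dom}(u)$ at $x$; if $\operatorname{dom}(u)$ lies in a hyperplane with unit normal $z$, the second integral is replaced by $(\rho_\varphi(z)+\rho_\varphi(-z))\int_{\operatorname{bd}(\operatorname{dom}(u))}|u|\,d\mathcal H^{n-1}$ (and the first one vanishes). Finally, $\overline V_{n+1}(u)=\int_{\operatorname{dom}(u)}|u(x)|\,dx$.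 Proposition. The function $\varphi=u^*$ is finite everywhere and belongs to $C_{\mathrm{rec}}(\mathbb R^n)$, with $\rho_{\varphi}=h_{\operatorname{dom}(u)}$ on $\mathbb R^n$. Furthermore, $\tilde\varphi=h_{K^u}$ on $\mathbb S^n$. All integrals in $Z_\varphi(u)$ and $\overline V_{n+1}(u)$ exist and are finite, and $$\frac1{n+1}\,Z_{\varphi}(u)=\overline V_{n+1}(u).$$ -/

import Mathlib

open Filter Topology MeasureTheory Set

noncomputable section

namespace ConvFun

/-- Euclidean space `ℝⁿ`. -/
abbrev E (n : ℕ) : Type := EuclideanSpace ℝ (Fin n)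

/-- Euclidean space `ℝⁿ⁺¹ = ℝⁿ × ℝ` with the Euclidean (not the sup) norm. -/
abbrev E1 (n : ℕ) : Type := WithLp 2 (E n × ℝ)

/-- The support function `h_K(x) = sup_{y ∈ K} ⟨x, y⟩` (a maximum for `K` compact, nonempty). -/
def supportFn {F : Type*} [NormedAddCommGroup F] [InnerProductSpace ℝ F]
    (K : Set F) (x : F) : ℝ :=
  sSup ((fun y => inner ℝ x y) '' K)

/-- The (effective) domain of an extended real valued function. -/
def dom {n : ℕ} (u : E n → EReal) : Set (E n) := {x | u x < ⊤}

/-- The epi-graph `{(x, t) ∈ ℝⁿ × ℝ : u(x) ≤ t}`. -/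
def epi {n : ℕ} (u : E n → EReal) : Set (E1 n) := {p | u p.fst ≤ (p.snd : EReal)}

/-- The orthogonal reflection `(x, t) ↦ (x, -t)` at the hyperplane `H = e_{n+1}^⊥`. -/
def reflH {n : ℕ} (p : E1 n) : E1 n := WithLp.toLp 2 (p.fst, -p.snd)

/-- The set `K^u = epi(u) ∩ refl_H(epi(u))`. -/
def body {n : ℕ} (u : E n → EReal) : Set (E1 n) := epi u ∩ reflH '' epi u

/-- The convex conjugate `u^*(y) = sup_x (⟨x, y⟩ - u(x))`. -/
def conj {n : ℕ} (u : E n → EReal) (y : E n) : EReal :=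
  ⨆ x : E n, ((inner ℝ x y : ℝ) : EReal) - u x

/-- Membership in `Conv_0`: proper, lower semicontinuous, convex functions
`u : ℝⁿ → (-∞, ∞]` with compact domain on which `u ≤ 0`. -/
structure IsConv0 {n : ℕ} (u : E n → EReal) : Prop where
  convex : Convex ℝ (epi u)
  lsc : LowerSemicontinuous u
  ne_bot : ∀ x, u x ≠ ⊥
  proper : (dom u).Nonempty
  compact_dom : IsCompact (dom u)
  nonpos : ∀ x ∈ dom u, u x ≤ 0

/-- The recession function: `ρ_φ(z) = lim_{t → ∞} φ(t z) / t` for unit vectors `z`, extended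
positively 1-homogeneously to `ℝⁿ`. The existence of the limits is part of `Crec` below. -/
def recession {n : ℕ} (φ : E n → ℝ) (x : E n) : ℝ :=
  ‖x‖ * limUnder atTop (fun t : ℝ => φ (t • (‖x‖⁻¹ • x)) / t)

/-- The space `C_rec(ℝⁿ)` of continuous functions that have a (finite) continuous recession
function at bounded distance from the function. -/
def Crec (n : ℕ) : Set (E n → ℝ) :=
  {φ | Continuous φ ∧
    (∀ z : E n, ‖z‖ = 1 → ∃ l : ℝ, Tendsto (fun t : ℝ => φ (t • z) / t) atTop (𝓝 l)) ∧
    Continuous (recession φ) ∧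
    ∃ C : ℝ, ∀ x, |recession φ x - φ x| ≤ C}

/-- The gnomonic projection `(ν₁, …, ν_n) / |ν_{n+1}|`, used for `ν_{n+1} < 0`. -/
def gnom {n : ℕ} (ν : E1 n) : E n := |ν.snd|⁻¹ • ν.fst

/-- The spherical function `φ̃` associated with `φ`; it is symmetric with respect to `H`. -/
def tildeFn {n : ℕ} (φ : E n → ℝ) (ν : E1 n) : ℝ :=
  if ν.snd < 0 then φ (gnom ν) / √(1 + ‖gnom ν‖ ^ 2)
  else if ν.snd = 0 then recession φ ν.fst
  else φ (gnom (reflH ν)) / √(1 + ‖gnom (reflH ν)‖ ^ 2)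

/-- The gradient of `u`; it is meaningful at the interior points of `dom u` at which `u` is
differentiable, that is, at almost every point of `dom u` if `u` is convex. -/
def grad {n : ℕ} (u : E n → EReal) (x : E n) : E n := gradient (fun y => (u y).toReal) x

/-- `z` is an outer unit normal vector of the convex set `K` at `x ∈ K`. -/
def IsOuterUnitNormal {n : ℕ} (K : Set (E n)) (x z : E n) : Prop :=
  ‖z‖ = 1 ∧ ∀ y ∈ K, inner ℝ (y - x) z ≤ 0

open Classical in
/-- The outer unit normal of `K` at `x` where it is unique (`0` elsewhere). -/
def gaussMap {n : ℕ} (K : Set (E n)) (x : E n) : E n :=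
  if h : ∃! z, IsOuterUnitNormal K x z then h.choose else 0

open Classical in
/-- A unit normal vector of a hyperplane that contains `K` (`0` if there is no such hyperplane). -/
def hyperplaneNormal {n : ℕ} (K : Set (E n)) : E n :=
  if h : ∃ z : E n, ‖z‖ = 1 ∧ ∃ c : ℝ, ∀ y ∈ K, inner ℝ y z = c then h.choose else 0

open Classical in
/-- The boundary term of `Z_φ(u)`. If `dom u` has dimension `n`, it is the integral of
`|u(x)| ρ_φ(ν(x))` over the boundary of `dom u`, with `ν` the outer unit normal. If `dom u` lies in
a hyperplane with unit normal `z`, it is the integral of `ρ_φ` against the measure which has mass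
`∫_{bd(dom u)} |u| dℋⁿ⁻¹` at each of the points `z` and `-z`. -/
def boundaryTerm {n : ℕ} (φ : E n → ℝ) (u : E n → EReal) : ℝ :=
  if affineSpan ℝ (dom u) = ⊤ then
    ∫ x in frontier (dom u), |(u x).toReal| * recession φ (gaussMap (dom u) x) ∂μHE[n - 1]
  else
    (recession φ (hyperplaneNormal (dom u)) + recession φ (-hyperplaneNormal (dom u))) *
      ∫ x in frontier (dom u), |(u x).toReal| ∂μHE[n - 1]

/-- The functional `Z_φ(u)`. -/
def Z {n : ℕ} (φ : E n → ℝ) (u : E n → EReal) : ℝ :=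
  (∫ x in dom u, φ (grad u x)) + boundaryTerm φ u

/-- The functional `V̄_{n+1}(u) = ∫_{dom u} |u(x)| dx`. -/
def Vbar {n : ℕ} (u : E n → EReal) : ℝ := ∫ x in dom u, |(u x).toReal|

end ConvFun

end

/-! Write `K` for the domain and `f` for `u` on it. Where `f` is differentiable, Fenchel's equality
(`supAffine_gradient`) gives `u^*(∇f(x)) = ⟨x, ∇f(x)⟩ - f(x)`. At a boundary point with normal
`ν(x)`, `h_K(ν(x)) = ⟨x, ν(x)⟩`, and `|f| = -f`. The divergence theorem for the field `f(x) x`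
(`integral_divergence`), `∫_K (n f + ⟨x, ∇f⟩) = ∫_{bd K} f ⟨x, ν⟩`, therefore cancels the boundary
term of `Z` and leaves `-(n+1) ∫_K f`. If `K` lies in a hyperplane with normal `z`, both sides
vanish, since `h_K(z) + h_K(-z) = 0`.

The work lies in the divergence theorem, because `f` is only convex and lower semicontinuous and its
gradient may be unbounded near `bd K`. With `0` in the interior, polar coordinates reduce it to
integrating the derivative of `rⁿ f(rθ)` along each ray (`lintegral_radialDeriv`). The result is an
integral of boundary values against the cone measure, which has density `⟨x, ν(x)⟩` with respect to
surface area (`coneMeasure_eq_withDensity`). This density is found by comparing small boundary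
patches with their radial projections to tangent hyperplanes, where the cone volume is explicit, up
to factors tending to `1`. It needs finite surface area, almost everywhere unique normals and a
measurable Gauss map; these follow from projecting points with nearby normals orthogonally.

The statements on `u^*` need no integration. As `f` is bounded, `u^*` and `h_K` are suprema over `K`
of functions at bounded distance, so `h_K` is the recession function. Maximizing a linear functional
over the vertical fibres of `K^u` gives the spherical function. -/

noncomputable section

namespace ConvFun

open scoped ENNReal NNReal Pointwise

/-! ### Hausdorff measure under Lipschitz and antilipschitz maps. -/

section Hausdorff

variable {X Y : Type*} [MetricSpace X] [MeasurableSpace X] [BorelSpace X]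
  [MetricSpace Y] [MeasurableSpace Y] [BorelSpace Y]

/-- A set has at most `c ^ d` times the `d`-dimensional measure of its image under a map that
contracts distances at most by the factor `c`. -/
lemma euclideanHausdorffMeasure_le_image {A : Set X} {T : X → Y} {c : ℝ≥0} (d : ℕ)
    (h : ∀ x ∈ A, ∀ y ∈ A, dist x y ≤ c * dist (T x) (T y)) :
    μHE[d] A ≤ (c : ℝ≥0∞) ^ d * μHE[d] (T '' A) := by
  have hT : AntilipschitzWith c (A.domRestrict T) :=
    AntilipschitzWith.of_le_mul_dist fun x y => h x x.2 y y.2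
  have h1 := hT.le_hausdorffMeasure_image (d := d) (by positivity) Set.univ
  have h2 : μHE[d] A = μHE[d] (Set.univ : Set A) := by
    have := (isometry_subtype_coe (s := A)).euclideanHausdorffMeasure_image (d := d) Set.univ
    rwa [Set.image_univ, Subtype.range_coe] at this
  -- Both measures are the same multiple of `μH[d]`, so the normalizing constant drops out.
  rw [h2, Measure.euclideanHausdorffMeasure_def, Measure.euclideanHausdorffMeasure_def,
    Measure.smul_apply, Measure.smul_apply, mul_smul_comm]
  refine smul_le_smul_of_nonneg_left ?_ zero_le
  rwa [Set.image_univ, Set.range_domRestrict, ENNReal.rpow_natCast] at h1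

lemma euclideanHausdorffMeasure_image_le {A : Set X} {T : X → Y} {c : ℝ≥0} (d : ℕ)
    (h : ∀ x ∈ A, ∀ y ∈ A, dist (T x) (T y) ≤ c * dist x y) :
    μHE[d] (T '' A) ≤ (c : ℝ≥0∞) ^ d * μHE[d] A := by
  have hT : LipschitzOnWith c T A := LipschitzOnWith.of_dist_le_mul h
  have h1 := hT.hausdorffMeasure_image_le (d := d) (by positivity)
  rw [Measure.euclideanHausdorffMeasure_def, Measure.euclideanHausdorffMeasure_def,
    Measure.smul_apply, Measure.smul_apply, mul_smul_comm]
  refine smul_le_smul_of_nonneg_left ?_ zero_le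
  rwa [ENNReal.rpow_natCast] at h1

end Hausdorff

/-! ### Surface area and uniqueness of normals. -/

section Normals

variable {n : ℕ} {K : Set (E n)}

/-- If `K` has unit normals close to `a` at two of its points, then these points lie almost on a
hyperplane orthogonal to `a`. -/
lemma abs_inner_sub_le {x y z w a : E n} {ε : ℝ} (hx : x ∈ K) (hy : y ∈ K)
    (hz : IsOuterUnitNormal K x z) (hw : IsOuterUnitNormal K y w)
    (hza : ‖z - a‖ ≤ ε) (hwa : ‖w - a‖ ≤ ε) : |inner ℝ (x - y) a| ≤ ε * ‖x - y‖ := by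
  -- Replacing the normal `z` by `a` in the support inequality costs at most `ε * ‖y - x‖`; using
  -- this at both points bounds the absolute value.
  have key : ∀ (x y z : E n), y ∈ K → IsOuterUnitNormal K x z → ‖z - a‖ ≤ ε →
      inner ℝ (y - x) a ≤ ε * ‖y - x‖ := by
    intro x y z hy hz hza
    have h1 := hz.2 y hy
    have h2 : inner ℝ (y - x) a = inner ℝ (y - x) z - inner ℝ (y - x) (z - a) := by
      rw [inner_sub_right]; ring
    have h3 := abs_real_inner_le_norm (y - x) (z - a)
    have h4 : ‖y - x‖ * ‖z - a‖ ≤ ε * ‖y - x‖ := by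
      rw [mul_comm]; gcongr
    have := neg_abs_le (inner ℝ (y - x) (z - a))
    linarith
  rw [abs_le]
  constructor
  · have h := key x y z hy hz hza
    rw [← neg_sub x y, inner_neg_left, norm_neg] at h
    linarith
  · exact key y x w hx hw hwa

/-- The points of `K` that have a unit normal within distance `ε` of `a`. -/
def nearNormal (K : Set (E n)) (a : E n) (ε : ℝ) : Set (E n) :=
  {x ∈ K | ∃ z, IsOuterUnitNormal K x z ∧ ‖z - a‖ ≤ ε}

lemma finrank_orthogonal_singleton {a : E n} (ha : a ≠ 0) :
    Module.finrank ℝ (ℝ ∙ a)ᗮ = n - 1 := by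
  have h := (ℝ ∙ a).finrank_add_finrank_orthogonal
  rw [finrank_span_singleton ha, finrank_euclideanSpace_fin] at h
  omega

/-- Differences of points of this set have at most half their length in direction `a`, so the
projection to `a^⊥` shrinks distances by at most a factor `2`, and its image is bounded in dimension
`n - 1`. -/
lemma measure_nearNormal_lt_top (hK : Bornology.IsBounded K) {a : E n} (ha : ‖a‖ = 1) :
    μHE[n - 1] (nearNormal K a (1 / 2)) < ⊤ := by
  have ha0 : a ≠ 0 := by rintro rfl; simp at ha
  let T : E n → (ℝ ∙ a)ᗮ := fun x => (ℝ ∙ a)ᗮ.orthogonalProjectionOnto x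
  have hT : ∀ x ∈ nearNormal K a (1 / 2), ∀ y ∈ nearNormal K a (1 / 2),
      dist x y ≤ (2 : ℝ≥0) * dist (T x) (T y) := by
    rintro x ⟨hx, z, hz, hza⟩ y ⟨hy, w, hw, hwa⟩
    have h1 := abs_inner_sub_le hx hy hz hw hza hwa
    have h2 : T x - T y = T (x - y) := (map_sub (ℝ ∙ a)ᗮ.orthogonalProjectionOnto x y).symm
    rw [dist_eq_norm, dist_eq_norm, h2]
    set v := x - y
    have h3 : ‖v‖ ≤ ‖(ℝ ∙ a).starProjection v‖ + ‖(ℝ ∙ a)ᗮ.starProjection v‖ := by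
      conv_lhs => rw [← (ℝ ∙ a).starProjection_add_starProjection_orthogonal v]
      exact norm_add_le _ _
    have h4 : ‖(ℝ ∙ a).starProjection v‖ = |inner ℝ v a| := by
      rw [Submodule.starProjection_unit_singleton ℝ ha, norm_smul, ha, real_inner_comm]
      simp
    have h5 : ‖(ℝ ∙ a)ᗮ.starProjection v‖ = ‖T v‖ := rfl
    rw [h4, h5] at h3
    push_cast
    linarith
  refine (euclideanHausdorffMeasure_le_image (n - 1) hT).trans_lt ?_
  refine ENNReal.mul_lt_top (by simp) ?_
  rw [← finrank_orthogonal_singleton ha0, InnerProductSpace.euclideanHausdorffMeasure_eq_volume]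
  refine Bornology.IsBounded.measure_lt_top ?_
  have hb : Bornology.IsBounded (nearNormal K a (1 / 2)) := hK.subset fun x hx => hx.1
  exact (ℝ ∙ a)ᗮ.orthogonalProjectionOnto.lipschitz.isBounded_image hb

/-- The measure of the set of points of a bounded set that have a unit normal is finite. -/
lemma measure_hasNormal_lt_top (hK : Bornology.IsBounded K) :
    μHE[n - 1] {x ∈ K | ∃ z, IsOuterUnitNormal K x z} < ⊤ := by
  obtain ⟨t, ht, hcov⟩ := (isCompact_sphere (0 : E n) 1).elim_nhds_subcover
    (fun a => Metric.closedBall a (1 / 2)) (fun a _ => Metric.closedBall_mem_nhds _ (by norm_num))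
  have hsub : {x ∈ K | ∃ z, IsOuterUnitNormal K x z} ⊆ ⋃ a ∈ t, nearNormal K a (1 / 2) := by
    rintro x ⟨hx, z, hz⟩
    have hz' : z ∈ Metric.sphere (0 : E n) 1 := by simp [hz.1]
    obtain ⟨a, hat, hza⟩ := mem_iUnion₂.1 (hcov hz')
    exact mem_iUnion₂.2 ⟨a, hat, hx, z, hz, by simpa [dist_eq_norm] using hza⟩
  refine (measure_mono hsub).trans_lt ((measure_biUnion_finset_le t _).trans_lt ?_)
  refine ENNReal.sum_lt_top.2 fun a ha => measure_nearNormal_lt_top hK ?_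
  simpa using ht a ha

lemma finrank_orthogonal_pair_lt {a b : E n} (hab : LinearIndependent ℝ ![a, b]) :
    Module.finrank ℝ (Submodule.span ℝ {a, b})ᗮ < n - 1 := by
  have h := (Submodule.span ℝ {a, b}).finrank_add_finrank_orthogonal
  have h2 : Module.finrank ℝ (Submodule.span ℝ {a, b}) = 2 := by
    have hr : ({a, b} : Set (E n)) = range ![a, b] := by
      rw [Matrix.range_cons, Matrix.range_cons, Matrix.range_empty, Set.union_empty,
        Set.singleton_union]
    rw [hr, finrank_span_eq_card hab, Fintype.card_fin]
  rw [h2, finrank_euclideanSpace_fin] at h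
  omega

/-- Differences of points of the intersection are almost orthogonal to both `a` and `b`, so the
projection to `{a, b}^⊥`, a space of dimension `n - 2`, is antilipschitz there. -/
lemma exists_measure_inter_nearNormal_eq_zero {a b : E n} (hab : LinearIndependent ℝ ![a, b]) :
    ∃ ε > 0, μHE[n - 1] (nearNormal K a ε ∩ nearNormal K b ε) = 0 := by
  let S := Submodule.span ℝ {a, b}
  let T : E n →ₗ[ℝ] Sᗮ × (ℝ × ℝ) :=
    (Sᗮ.orthogonalProjectionOnto : E n →ₗ[ℝ] Sᗮ).prod
      ((innerₛₗ ℝ a).prod (innerₛₗ ℝ b))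
  have hker : LinearMap.ker T = ⊥ := by
    rw [LinearMap.ker_eq_bot']
    intro x hx
    have h1 : Sᗮ.orthogonalProjectionOnto x = 0 := congrArg Prod.fst hx
    have h2 : inner ℝ a x = 0 := congrArg (fun p => p.2.1) hx
    have h3 : inner ℝ b x = 0 := congrArg (fun p => p.2.2) hx
    have h4 : x ∈ Sᗮ := by
      rw [Submodule.mem_orthogonal]
      intro u hu
      induction hu using Submodule.span_induction with
      | mem u hu => rcases hu with rfl | rfl <;> assumption
      | zero => simp
      | add u v _ _ hu hv => rw [inner_add_left, hu, hv, add_zero]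
      | smul c u _ hu => rw [inner_smul_left, hu, mul_zero]
    have h5 := Submodule.orthogonalProjectionOnto_mem_subspace_eq_self (⟨x, h4⟩ : Sᗮ)
    rw [h1] at h5
    exact (congrArg Subtype.val h5).symm
  obtain ⟨c, hc, hT⟩ := T.exists_antilipschitzWith hker
  -- With this `ε`, `c` times the components along `a` and `b` is at most `‖x - y‖ / 2`, so for `x ≠
  -- y` the maximum in the product metric must come from the projection.
  refine ⟨(2 * c)⁻¹, by positivity, ?_⟩
  have hP : ∀ x ∈ nearNormal K a (2 * c)⁻¹ ∩ nearNormal K b (2 * c)⁻¹,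
      ∀ y ∈ nearNormal K a (2 * c)⁻¹ ∩ nearNormal K b (2 * c)⁻¹,
      dist x y ≤ c * dist (Sᗮ.orthogonalProjectionOnto x) (Sᗮ.orthogonalProjectionOnto y) := by
    rintro x ⟨⟨hx, z, hz, hza⟩, ⟨-, z', hz', hzb⟩⟩ y ⟨⟨hy, w, hw, hwa⟩, ⟨-, w', hw', hwb⟩⟩
    have h1 := abs_inner_sub_le hx hy hz hw hza hwa
    have h2 := abs_inner_sub_le hx hy hz' hw' hzb hwb
    have h3 := hT.le_mul_dist x y
    have h4 : dist (T x) (T y) = max (dist (Sᗮ.orthogonalProjectionOnto x)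
        (Sᗮ.orthogonalProjectionOnto y)) (max |inner ℝ (x - y) a| |inner ℝ (x - y) b|) := by
      rw [Prod.dist_eq, Prod.dist_eq, Real.dist_eq, Real.dist_eq, inner_sub_left, inner_sub_left,
        real_inner_comm a x, real_inner_comm a y, real_inner_comm b x, real_inner_comm b y]
      rfl
    rw [h4] at h3
    rcases eq_or_ne x y with rfl | hxy
    · simp
    have hpos : 0 < ‖x - y‖ := norm_pos_iff.2 (sub_ne_zero.2 hxy)
    rcases max_choice (dist (Sᗮ.orthogonalProjectionOnto x)
        (Sᗮ.orthogonalProjectionOnto y)) (max |inner ℝ (x - y) a| |inner ℝ (x - y) b|) with h | h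
    · rwa [h] at h3
    · exfalso
      rw [h, dist_eq_norm] at h3
      have h5 := max_le h1 h2
      have hc' : (0 : ℝ) < c := hc
      have h6 : (c : ℝ) * max |inner ℝ (x - y) a| |inner ℝ (x - y) b|
          ≤ c * ((2 * (c : ℝ))⁻¹ * ‖x - y‖) := by gcongr
      have h7 : (c : ℝ) * ((2 * (c : ℝ))⁻¹ * ‖x - y‖) = ‖x - y‖ / 2 := by field_simp
      linarith
  refine le_antisymm ((euclideanHausdorffMeasure_le_image (n - 1) hP).trans ?_) zero_le
  refine le_of_eq_of_le (b := (c : ℝ≥0∞) ^ (n - 1) * 0) ?_ (by simp)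
  congr 1
  rw [Measure.euclideanHausdorffMeasure_def, Measure.smul_apply]
  have h0 : μH[((n - 1 : ℕ) : ℝ≥0)] (univ : Set Sᗮ) = 0 := by
    refine hausdorffMeasure_of_dimH_lt ?_
    rw [Real.dimH_univ_eq_finrank]
    exact_mod_cast finrank_orthogonal_pair_lt hab
  rw [NNReal.coe_natCast] at h0
  rw [measure_mono_null (subset_univ _) h0, smul_zero]

/-- Dependent unit vectors that differ are opposite, and opposite normals would force `K` into a
hyperplane. -/
lemma linearIndependent_of_normal {x z w : E n} (hint : (interior K).Nonempty)
    (hz : IsOuterUnitNormal K x z) (hw : IsOuterUnitNormal K x w) (hne : z ≠ w) :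
    LinearIndependent ℝ ![z, w] := by
  have hz0 : z ≠ 0 := by rintro rfl; simpa using hz.1
  rw [LinearIndependent.pair_iff' hz0]
  rintro c rfl
  have hc : |c| = 1 := by simpa [norm_smul, hz.1] using hw.1
  rcases eq_or_eq_neg_of_abs_eq hc with rfl | rfl
  · simp at hne
  have hK : ∀ y ∈ K, inner ℝ (y - x) z = 0 := by
    intro y hy
    have h1 := hz.2 y hy
    have h2 := hw.2 y hy
    rw [inner_smul_right] at h2
    linarith
  obtain ⟨p, hp⟩ := hint
  obtain ⟨r, hr, hball⟩ := Metric.mem_nhds_iff.1 (mem_interior_iff_mem_nhds.1 hp)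
  have h3 := hK p (hball (Metric.mem_ball_self hr))
  have h4 := hK (p + (r / 2) • z) (hball (by
    simp [norm_smul, hz.1, abs_of_pos hr, hr]))
  rw [add_sub_right_comm, inner_add_left, h3, inner_smul_left, real_inner_self_eq_norm_sq,
    hz.1] at h4
  simp at h4
  linarith

/-- Almost every boundary point of a convex body has at most one outer unit normal. -/
lemma measure_not_unique_normal (hint : (interior K).Nonempty) :
    μHE[n - 1] {x ∈ K | ∃ z w, IsOuterUnitNormal K x z ∧ IsOuterUnitNormal K x w ∧ z ≠ w} = 0 := by
  let S : Set (E n × E n) := {p | LinearIndependent ℝ ![p.1, p.2]}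
  choose! ε hε hnull using fun (p : E n × E n) (hp : p ∈ S) =>
    exists_measure_inter_nearNormal_eq_zero (K := K) hp
  -- By the Lindelöf property, countably many of the null sets catch every pair of independent
  -- normals.
  obtain ⟨t, htS, ht, hcov⟩ := TopologicalSpace.countable_cover_nhdsWithin
    (s := S) (f := fun p => Metric.closedBall p (ε p)) fun p hp =>
      mem_nhdsWithin_of_mem_nhds (Metric.closedBall_mem_nhds _ (hε p hp))
  refine measure_mono_null (t := ⋃ p ∈ t, nearNormal K p.1 (ε p) ∩ nearNormal K p.2 (ε p)) ?_
    ((measure_biUnion_null_iff ht).2 fun p hp => hnull p (htS hp))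
  rintro x ⟨hx, z, w, hz, hw, hne⟩
  obtain ⟨p, hp, hzw⟩ := mem_iUnion₂.1 (hcov (show (z, w) ∈ S from
    linearIndependent_of_normal hint hz hw hne))
  rw [Metric.mem_closedBall, Prod.dist_eq, max_le_iff, dist_eq_norm, dist_eq_norm] at hzw
  exact mem_iUnion₂.2 ⟨p, hp, ⟨hx, z, hz, hzw.1⟩, ⟨hx, w, hw, hzw.2⟩⟩

end Normals

/-! ### Existence of normals and measurability of the Gauss map. -/

section GaussMap

variable {n : ℕ} {K : Set (E n)}

/-- The pairs of a boundary point of `K` and an outer unit normal at this point. -/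
def normalPairs (K : Set (E n)) : Set (E n × E n) :=
  {p | p.1 ∈ frontier K ∧ IsOuterUnitNormal K p.1 p.2}

/-- Compactness makes sets of boundary points cut out by closed conditions on point and normal
closed, as projections of compact sets; hence they are measurable. -/
lemma isCompact_normalPairs (hK : IsCompact K) : IsCompact (normalPairs K) := by
  have hf : IsCompact (frontier K) := hK.of_isClosed_subset isClosed_frontier
    hK.isClosed.frontier_subset
  refine (hf.prod (isCompact_sphere (0 : E n) 1)).of_isClosed_subset ?_ ?_
  · have : normalPairs K = {p | p.1 ∈ frontier K} ∩ ({p | ‖p.2‖ = 1} ∩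
        ⋂ y ∈ K, {p : E n × E n | inner ℝ (y - p.1) p.2 ≤ 0}) := by
      ext p
      simp [normalPairs, IsOuterUnitNormal]
    rw [this]
    refine (isClosed_frontier.preimage continuous_fst).inter
      ((isClosed_eq (by fun_prop) continuous_const).inter (isClosed_biInter fun y _ =>
        isClosed_le (by fun_prop) continuous_const))
  · rintro p ⟨h1, h2⟩
    exact ⟨h1, by simpa using h2.1⟩

/-- Hahn–Banach separates `x` from the interior, and the inequality passes to `K`, which lies in the
closure of its interior. -/
lemma exists_normal_of_mem_frontier (hK : Convex ℝ K) (hint : (interior K).Nonempty) {x : E n}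
    (hx : x ∈ frontier K) : ∃ z, IsOuterUnitNormal K x z := by
  obtain ⟨f, hf⟩ := geometric_hahn_banach_open_point hK.interior isOpen_interior hx.2
  let w := (InnerProductSpace.toDual ℝ (E n)).symm f
  have hw : ∀ y, inner ℝ w y = f y := fun y => by simp [w]
  have hw0 : w ≠ 0 := by
    intro h
    obtain ⟨p, hp⟩ := hint
    have := hf p hp
    rw [← hw, ← hw, h, inner_zero_left, inner_zero_left] at this
    exact lt_irrefl _ this
  have hle : ∀ y ∈ K, f y ≤ f x := by
    intro y hy
    have hy' : y ∈ closure (interior K) := by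
      rw [hK.closure_interior_eq_closure_of_nonempty_interior hint]
      exact subset_closure hy
    refine closure_minimal (fun z hz => (hf z hz).le) (isClosed_le f.continuous
      continuous_const) hy'
  refine ⟨‖w‖⁻¹ • w, ?_, fun y hy => ?_⟩
  · rw [norm_smul, norm_inv, norm_norm, inv_mul_cancel₀ (norm_ne_zero_iff.2 hw0)]
  · rw [inner_smul_right, real_inner_comm, hw, map_sub]
    have := hle y hy
    have h2 : 0 ≤ ‖w‖⁻¹ := by positivity
    nlinarith

lemma gaussMap_eq {x z : E n} (hz : IsOuterUnitNormal K x z)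
    (h : ∀ w, IsOuterUnitNormal K x w → w = z) : gaussMap K x = z := by
  have hex : ∃! z, IsOuterUnitNormal K x z := ⟨z, hz, h⟩
  rw [gaussMap, dif_pos hex]
  exact h _ hex.choose_spec.1

lemma norm_gaussMap_le (x : E n) : ‖gaussMap K x‖ ≤ 1 := by
  unfold gaussMap
  split_ifs with h
  · exact h.choose_spec.1.1.le
  · simp

lemma ae_frontier_normal_eq_gaussMap (hc : IsClosed K) (hK : Convex ℝ K)
    (hint : (interior K).Nonempty) :
    ∀ᵐ x ∂(μHE[n - 1].restrict (frontier K)), IsOuterUnitNormal K x (gaussMap K x) ∧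
      ∀ z, IsOuterUnitNormal K x z → z = gaussMap K x := by
  rw [ae_restrict_iff' isClosed_frontier.measurableSet]
  have h0 := measure_eq_zero_iff_ae_notMem.1 (measure_not_unique_normal hint)
  filter_upwards [h0] with x hx hxf
  obtain ⟨z, hz⟩ := exists_normal_of_mem_frontier hK hint hxf
  have huniq : ∀ w, IsOuterUnitNormal K x w → w = z := fun w hw => by
    by_contra hne
    exact hx ⟨hc.frontier_subset hxf, w, z, hw, hz, hne⟩
  have hg := gaussMap_eq hz huniq
  rw [hg]
  exact ⟨hz, huniq⟩

/-- Where normals are unique, the preimage of a closed set `F` is the projection of the compact set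
of normal pairs with normal in `F`. -/
lemma aemeasurable_gaussMap (hc : IsCompact K) (hK : Convex ℝ K) (hint : (interior K).Nonempty) :
    AEMeasurable (gaussMap K) (μHE[n - 1].restrict (frontier K)) := by
  have h0 := ae_frontier_normal_eq_gaussMap hc.isClosed hK hint
  rw [ae_restrict_iff' isClosed_frontier.measurableSet] at h0
  obtain ⟨t, ht, htm, ht0⟩ := exists_measurable_superset_of_null (ae_iff.1 h0)
  have hS : MeasurableSet (frontier K \ t) := isClosed_frontier.measurableSet.diff htm
  have hSeq : (frontier K \ t : Set (E n)) =ᵐ[μHE[n - 1]] frontier K :=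
    sdiff_null_ae_eq_self ht0
  rw [← Measure.restrict_congr_set hSeq]
  refine aemeasurable_restrict_of_measurable_subtype hS (measurable_of_isClosed fun F hF => ?_)
  have hcomp : IsCompact (Prod.fst '' (normalPairs K ∩ Prod.snd ⁻¹' F)) :=
    ((isCompact_normalPairs hc).inter_right (hF.preimage continuous_snd)).image continuous_fst
  convert measurable_subtype_coe hcomp.isClosed.measurableSet using 1
  ext ⟨x, hxf, hxt⟩
  have hx : IsOuterUnitNormal K x (gaussMap K x) ∧
      ∀ z, IsOuterUnitNormal K x z → z = gaussMap K x := by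
    by_contra hcon
    exact hxt (ht fun h => hcon (h hxf))
  constructor
  · intro h
    exact ⟨(x, gaussMap K x), ⟨⟨hxf, hx.1⟩, h⟩, rfl⟩
  · rintro ⟨⟨x', z⟩, ⟨⟨-, hz⟩, hzF⟩, rfl⟩
    exact (show gaussMap K x' = z from (hx.2 z hz).symm) ▸ hzF

end GaussMap

/-! ### Volume of cones over flat bases. -/

section FlatCone

variable {n : ℕ}

lemma lintegral_Ioc_div_pow (hn : 1 ≤ n) {h : ℝ} (hh : 0 < h) :
    (n : ℝ≥0∞) * ∫⁻ x in Ioc 0 h, ENNReal.ofReal ((x / h) ^ (n - 1)) = ENNReal.ofReal h := by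
  obtain ⟨m, rfl⟩ : ∃ m, n = m + 1 := ⟨n - 1, by omega⟩
  have hint : IntegrableOn (fun x : ℝ => (x / h) ^ m) (Ioc 0 h) :=
    (Continuous.integrableOn_Icc (by fun_prop)).mono_set Ioc_subset_Icc_self
  rw [Nat.add_sub_cancel, ← ofReal_integral_eq_lintegral_ofReal hint,
    ← intervalIntegral.integral_of_le hh.le, ← ENNReal.ofReal_natCast,
    ← ENNReal.ofReal_mul (by positivity)]
  · congr 1
    simp_rw [div_pow]
    rw [intervalIntegral.integral_div, integral_pow]
    push_cast
    field_simp
    simp only [sub_zero, ne_eq, Nat.add_eq_zero_iff, one_ne_zero, and_false, not_false_eq_true,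
      zero_pow]
    ring
  · filter_upwards [ae_restrict_mem measurableSet_Ioc] with x hx
    have := hx.1
    positivity

/-- The volume of a cone over a subset of a hyperplane. -/
lemma volume_flatCone (hn : 1 ≤ n) {a : E n} (ha : ‖a‖ = 1) {h : ℝ} (hh : 0 < h) {B : Set (E n)}
    (hB : MeasurableSet B) (hBa : ∀ b ∈ B, inner ℝ b a = h) :
    (n : ℝ≥0∞) * volume {z : E n | 0 < inner ℝ z a ∧ inner ℝ z a ≤ h ∧
      (h / inner ℝ z a : ℝ) • z ∈ B} = ENNReal.ofReal h * μHE[n - 1] B := by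
  have ha0 : a ≠ 0 := by rintro rfl; simp at ha
  set C : Set (E n) := {z : E n | 0 < inner ℝ z a ∧ inner ℝ z a ≤ h ∧
      (h / inner ℝ z a : ℝ) • z ∈ B} with hC
  have hCm : MeasurableSet C := by
    have h1 : Measurable fun z : E n => (inner ℝ z a : ℝ) := by fun_prop
    have h2 : Measurable fun z : E n => (h / inner ℝ z a : ℝ) • z :=
      (h1.const_div h).smul measurable_id
    exact (measurableSet_lt measurable_const h1).inter
      ((measurableSet_le h1 measurable_const).inter (h2 hB))
  -- The slice at height `x` is the dilate `(x / h) • B`; integrating over heights gives the volume.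
  have hslice : ∀ x : ℝ, μHE[n - 1] (C ∩ AffineSubspace.mk' (x • a +ᵥ (0 : E n)) (ℝ ∙ a)ᗮ) =
      (Ioc 0 h).indicator (fun x => ENNReal.ofReal ((x / h) ^ (n - 1)) * μHE[n - 1] B) x := by
    intro x
    have hmem : ∀ z, z ∈ (AffineSubspace.mk' (x • a +ᵥ (0 : E n)) (ℝ ∙ a)ᗮ) ↔
        inner ℝ z a = x := by
      intro z
      rw [AffineSubspace.mem_mk', Submodule.mem_orthogonal_singleton_iff_inner_left]
      simp only [vadd_eq_add, add_zero, vsub_eq_sub, inner_sub_left, inner_smul_left,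
        real_inner_self_eq_norm_sq, ha]
      simp [sub_eq_zero]
    by_cases hx : x ∈ Ioc 0 h
    · rw [indicator_of_mem hx]
      have hx0 : x ≠ 0 := hx.1.ne'
      have hset : C ∩ AffineSubspace.mk' (x • a +ᵥ (0 : E n)) (ℝ ∙ a)ᗮ = (x / h) • B := by
        ext z
        rw [mem_inter_iff, SetLike.mem_coe, hmem]
        constructor
        · rintro ⟨⟨h1, h2, h3⟩, rfl⟩
          refine ⟨_, h3, ?_⟩
          simp only [smul_smul]
          rw [div_mul_div_cancel₀ hh.ne', div_self hx0, one_smul]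
        · rintro ⟨b, hb, rfl⟩
          have h1 : inner ℝ ((x / h) • b) a = x := by
            rw [inner_smul_left, hBa b hb]
            simp [hh.ne']
          refine ⟨?_, h1⟩
          simp only [hC, mem_ofPred_eq, h1]
          refine ⟨hx.1, hx.2, ?_⟩
          rw [smul_smul, div_mul_div_cancel₀ hx0, div_self hh.ne', one_smul]
          exact hb
      have hpos : 0 < x / h := div_pos hx.1 hh
      rw [hset, Measure.euclideanHausdorffMeasure_smul₀ _ hpos.ne', ENNReal.smul_def, smul_eq_mul]
      congr 1
      rw [ENNReal.ofReal_pow hpos.le, ENNReal.coe_pow]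
      congr 1
      exact Real.enorm_of_nonneg hpos.le
    · rw [indicator_of_notMem hx]
      convert measure_empty (μ := μHE[n - 1])
      ext z
      rw [mem_inter_iff, SetLike.mem_coe, hmem]
      constructor
      · rintro ⟨⟨h1, h2, -⟩, rfl⟩
        exact hx ⟨h1, h2⟩
      · rintro ⟨⟩
  have hvol : volume C = ∫⁻ x : ℝ, μHE[n - 1] (C ∩ AffineSubspace.mk' (x • a +ᵥ (0 : E n))
      (ℝ ∙ a)ᗮ) := by
    have := EuclideanGeometry.euclideanHausdorffMeasure_eq_lintegral (0 : E n) ha0 hCm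
    rw [InnerProductSpace.euclideanHausdorffMeasure_eq_volume, finrank_euclideanSpace_fin] at this
    rw [this, ← ofReal_norm, ha]
    simp
  rw [hvol]
  simp_rw [hslice]
  rw [lintegral_indicator measurableSet_Ioc, lintegral_mul_const _ (by fun_prop), ← mul_assoc,
    lintegral_Ioc_div_pow hn hh]

end FlatCone

/-! ### The cone measure and its density with respect to surface area. -/

section ConeMeasure

variable {n : ℕ} {K : Set (E n)}

/-- The radial projection onto the boundary of a convex body that contains `0` in its interior. -/
def radialProj (K : Set (E n)) (z : E n) : E n := (gauge K z)⁻¹ • z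

lemma gauge_pos_of_ne_zero (hc : IsCompact K) (h0 : (0 : E n) ∈ interior K) {z : E n}
    (hz : z ≠ 0) : 0 < gauge K z :=
  (gauge_pos (absorbent_nhds_zero (mem_interior_iff_mem_nhds.1 h0))
    (NormedSpace.isVonNBounded_of_isBounded ℝ hc.isBounded)).2 hz

lemma mem_iff_gauge_le_one (hc : IsCompact K) (hK : Convex ℝ K) (h0 : (0 : E n) ∈ interior K)
    {z : E n} : z ∈ K ↔ gauge K z ≤ 1 := by
  rw [gauge_le_one_iff_mem_closure hK (mem_interior_iff_mem_nhds.1 h0), hc.isClosed.closure_eq]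

lemma gauge_smul_pos {t : ℝ} (ht : 0 ≤ t) (z : E n) : gauge K (t • z) = t * gauge K z := by
  rw [gauge_smul_of_nonneg ht, smul_eq_mul]

lemma radialProj_smul {t : ℝ} (ht : 0 < t) (z : E n) : radialProj K (t • z) = radialProj K z := by
  rw [radialProj, radialProj, gauge_smul_pos ht.le, smul_smul, mul_inv, mul_comm t⁻¹, mul_assoc,
    inv_mul_cancel₀ ht.ne', mul_one]

lemma radialProj_of_mem_frontier (hK : Convex ℝ K) (h0 : (0 : E n) ∈ interior K) {x : E n}
    (hx : x ∈ frontier K) : radialProj K x = x := by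
  rw [radialProj, (gauge_eq_one_iff_mem_frontier hK (mem_interior_iff_mem_nhds.1 h0)).2 hx,
    inv_one, one_smul]

lemma radialProj_mem_frontier (hc : IsCompact K) (hK : Convex ℝ K) (h0 : (0 : E n) ∈ interior K)
    {z : E n} (hz : z ≠ 0) : radialProj K z ∈ frontier K := by
  have hg := gauge_pos_of_ne_zero hc h0 hz
  rw [← gauge_eq_one_iff_mem_frontier hK (mem_interior_iff_mem_nhds.1 h0), radialProj,
    gauge_smul_pos (inv_nonneg.2 hg.le), inv_mul_cancel₀ hg.ne']

lemma gauge_smul_radialProj (hc : IsCompact K) (h0 : (0 : E n) ∈ interior K) (z : E n) :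
    gauge K z • radialProj K z = z := by
  rcases eq_or_ne z 0 with rfl | hz
  · simp [radialProj]
  · rw [radialProj, smul_smul, mul_inv_cancel₀ (gauge_pos_of_ne_zero hc h0 hz).ne', one_smul]

lemma measurable_radialProj (hK : Convex ℝ K) (h0 : (0 : E n) ∈ interior K) :
    Measurable (radialProj K) :=
  (continuous_gauge hK (mem_interior_iff_mem_nhds.1 h0)).measurable.inv.smul measurable_id

lemma radialProj_zero : radialProj K 0 = 0 := by simp [radialProj]

/-- The cone measure of `K`: a subset `A` of the boundary is assigned `n` times the volume of the
cone `[0, 1] • A`. -/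
def coneMeasure (K : Set (E n)) : Measure (E n) :=
  (n : ℝ≥0∞) • (volume.restrict K).map (radialProj K)

lemma coneMeasure_apply (hK : Convex ℝ K) (h0 : (0 : E n) ∈ interior K) {A : Set (E n)}
    (hA : MeasurableSet A) :
    coneMeasure K A = n * volume (radialProj K ⁻¹' A ∩ K) := by
  rw [coneMeasure, Measure.smul_apply, Measure.map_apply (measurable_radialProj hK h0) hA,
    Measure.restrict_apply (measurable_radialProj hK h0 hA), smul_eq_mul]

/-- The volume of a subset of a dilate of `T` is bounded by that of `T`. -/
lemma volume_le_of_subset_smul {c : ℝ≥0} (S T : Set (E n)) (h : S ⊆ (c : ℝ) • T) :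
    volume S ≤ (c : ℝ≥0∞) ^ n * volume T := by
  refine (measure_mono h).trans (le_of_eq ?_)
  rw [Measure.addHaar_smul, finrank_euclideanSpace_fin, abs_of_nonneg (by positivity),
    ENNReal.ofReal_pow (by positivity), ENNReal.ofReal_coe_nnreal]

variable {x₀ a : E n} {ε R : ℝ} {c : ℝ≥0}

/-- The part of the boundary of `K` that is close to `x₀`, with a normal close to `a`. -/
def normalPatch (K : Set (E n)) (x₀ a : E n) (ε : ℝ) : Set (E n) :=
  {x | x ∈ frontier K ∧ ‖x - x₀‖ ≤ ε ∧ ∃ z, IsOuterUnitNormal K x z ∧ ‖z - a‖ ≤ ε}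

/-- Near a boundary point, the radial projection onto a tangent hyperplane is almost isometric. -/
lemma norm_tangent_proj_sub {h : ℝ} {x y : E n} (hε : ε < h) (hR : ‖y‖ ≤ R)
    (hx : |inner ℝ x a - h| ≤ ε) (hy : |inner ℝ y a - h| ≤ ε)
    (hxy : |inner ℝ (x - y) a| ≤ ε * ‖x - y‖)
    (h1 : h / (h - ε) + h * R * ε / (h - ε) ^ 2 ≤ c)
    (h2 : (c : ℝ)⁻¹ ≤ h / (h + ε) - h * R * ε / (h - ε) ^ 2) :
    ‖(h / inner ℝ x a) • x - (h / inner ℝ y a) • y‖ ≤ c * ‖x - y‖ ∧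
      (c : ℝ)⁻¹ * ‖x - y‖ ≤ ‖(h / inner ℝ x a) • x - (h / inner ℝ y a) • y‖ := by
  have hε0 : 0 ≤ ε := (abs_nonneg _).trans hx
  have hh : 0 < h := by linarith
  have hR0 : 0 ≤ R := (norm_nonneg _).trans hR
  rw [inner_sub_left] at hxy
  set s : ℝ := inner ℝ x a
  set t : ℝ := inner ℝ y a
  rw [abs_le] at hx hy
  have hd : 0 < h - ε := by linarith
  have hs : h - ε ≤ s := by linarith [hx.1]
  have hs' : s ≤ h + ε := by linarith [hx.2]
  have ht : h - ε ≤ t := by linarith [hy.1]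
  have hs0 : 0 < s := hd.trans_le hs
  have ht0 : 0 < t := hd.trans_le ht
  -- The first term is almost `x - y`; the second comes from the different scaling factors and is
  -- small because `|s - t| ≤ ε * ‖x - y‖`.
  have heq : (h / s) • x - (h / t) • y = (h / s) • (x - y) + (h * (t - s) / (s * t)) • y := by
    have : h / t = h / s - h * (t - s) / (s * t) := by field_simp; ring
    rw [this, sub_smul, smul_sub]
    abel
  have hn1 : ‖(h / s) • (x - y)‖ = h / s * ‖x - y‖ := by
    rw [norm_smul, Real.norm_of_nonneg (by positivity)]
  have hn2 : ‖(h * (t - s) / (s * t)) • y‖ ≤ h * R * ε / (h - ε) ^ 2 * ‖x - y‖ := by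
    rw [norm_smul, Real.norm_eq_abs, abs_div, abs_mul, abs_of_pos hh, abs_of_pos (mul_pos hs0 ht0),
      abs_sub_comm]
    have : h * |s - t| / (s * t) ≤ h * (ε * ‖x - y‖) / ((h - ε) * (h - ε)) := by gcongr
    calc h * |s - t| / (s * t) * ‖y‖ ≤ h * (ε * ‖x - y‖) / ((h - ε) * (h - ε)) * R := by gcongr
      _ = _ := by ring
  have hl : h / s ≤ h / (h - ε) := by gcongr
  have hl' : h / (h + ε) ≤ h / s := by gcongr
  have hN : 0 ≤ ‖x - y‖ := norm_nonneg _
  rw [heq]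
  constructor
  · refine (norm_add_le _ _).trans ?_
    rw [hn1]
    nlinarith
  · have := norm_sub_norm_le ((h / s) • (x - y)) (-((h * (t - s) / (s * t)) • y))
    rw [sub_neg_eq_add, norm_neg, hn1] at this
    nlinarith

/-- The cone measure of a small part of the boundary of `K` is comparable to its surface area times
the height of a tangent hyperplane. -/
lemma coneMeasure_comparable (hn : 1 ≤ n) (hc : IsCompact K) (hK : Convex ℝ K)
    (h0 : (0 : E n) ∈ interior K) {h : ℝ} (ha : ‖a‖ = 1) (hh : inner ℝ x₀ a = h) (hε : ε < h)
    (hε0 : 0 ≤ ε) (hR : ∀ x ∈ K, ‖x‖ ≤ R) (hc0 : 0 < c)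
    (h1 : h / (h - ε) + h * R * ε / (h - ε) ^ 2 ≤ c)
    (h2 : (c : ℝ)⁻¹ ≤ h / (h + ε) - h * R * ε / (h - ε) ^ 2)
    {A : Set (E n)} (hA : MeasurableSet A) (hAs : A ⊆ normalPatch K x₀ a ε) :
    coneMeasure K A ≤ (c : ℝ≥0∞) ^ n * (ENNReal.ofReal h * ((c : ℝ≥0∞) ^ (n - 1) *
      μHE[n - 1] A)) ∧
    ENNReal.ofReal h * μHE[n - 1] A ≤ (c : ℝ≥0∞) ^ (n - 1) * ((c : ℝ≥0∞) ^ n *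
      coneMeasure K A) := by
  have hcl := hc.isClosed
  have hh0 : 0 < h := by linarith
  have hd : 0 < h - ε := by linarith
  have hc0' : (0 : ℝ) < c := hc0
  have hin : ∀ x ∈ A, |inner ℝ x a - h| ≤ ε := by
    intro x hx
    rw [← hh, ← inner_sub_left]
    refine (abs_real_inner_le_norm _ _).trans ?_
    rw [ha, mul_one]
    exact (hAs hx).2.1
  have hpos : ∀ x ∈ A, 0 < inner ℝ x a := fun x hx => by
    have := (abs_le.1 (hin x hx)).1
    linarith
  have hbd : ∀ x ∈ A, h / inner ℝ x a ≤ c ∧ inner ℝ x a ≤ c * h := by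
    intro x hx
    obtain ⟨h3, h4⟩ := abs_le.1 (hin x hx)
    have hR0 : 0 ≤ R := (norm_nonneg _).trans (hR x (hcl.frontier_subset (hAs hx).1))
    have hrem : 0 ≤ h * R * ε / (h - ε) ^ 2 := by positivity
    constructor
    · have : h / inner ℝ x a ≤ h / (h - ε) := by
        have := hpos x hx
        gcongr
        linarith
      linarith
    · have h5 : (c : ℝ)⁻¹ ≤ h / (h + ε) := by linarith
      rw [inv_eq_one_div, div_le_div_iff₀ hc0' (by linarith)] at h5
      linarith
  have hlip : ∀ x ∈ A, ∀ y ∈ A,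
      ‖(h / inner ℝ x a) • x - (h / inner ℝ y a) • y‖ ≤ c * ‖x - y‖ ∧
      (c : ℝ)⁻¹ * ‖x - y‖ ≤ ‖(h / inner ℝ x a) • x - (h / inner ℝ y a) • y‖ := by
    intro x hx y hy
    obtain ⟨hxf, -, z, hz, hza⟩ := hAs hx
    obtain ⟨hyf, -, w, hw, hwa⟩ := hAs hy
    have hxK := hcl.frontier_subset hxf
    have hyK := hcl.frontier_subset hyf
    exact norm_tangent_proj_sub hε (hR y hyK) (hin x hx) (hin y hy)
      (abs_inner_sub_le hxK hyK hz hw hza hwa) h1 h2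
  have hq : ∀ x ∈ A, radialProj K x = x := fun x hx =>
    radialProj_of_mem_frontier hK h0 (hAs hx).1
  -- `ψ` moves `A` radially into the hyperplane `⟨z, a⟩ = h` through `x₀`, with image `B`. The cone
  -- over `A` and the flat cone over `B` then agree up to dilation by `c`.
  set ψ : E n → E n := fun x => (h / inner ℝ x a : ℝ) • x with hψ
  set B : Set (E n) := {z | inner ℝ z a = h ∧ radialProj K z ∈ A} with hBdef
  have hBm : MeasurableSet B :=
    (measurableSet_eq_fun (by fun_prop) measurable_const).inter (measurable_radialProj hK h0 hA)
  have hBψ : B = ψ '' A := by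
    ext z
    constructor
    · rintro ⟨hz, hzA⟩
      refine ⟨_, hzA, ?_⟩
      have hz0 : z ≠ 0 := by rintro rfl; simp at hz; linarith
      have hg := gauge_pos_of_ne_zero hc h0 hz0
      simp only [hψ, radialProj, inner_smul_left, hz, smul_smul]
      simp only [conj_trivial]
      rw [show h / ((gauge K z)⁻¹ * h) * (gauge K z)⁻¹ = 1 by field_simp, one_smul]
    · rintro ⟨x, hx, rfl⟩
      have hp := hpos x hx
      refine ⟨?_, ?_⟩
      · simp only [hψ, inner_smul_left, conj_trivial]
        field_simp
      · rw [hψ, radialProj_smul (div_pos hh0 hp), hq x hx]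
        exact hx
  have hHB : μHE[n - 1] B ≤ (c : ℝ≥0∞) ^ (n - 1) * μHE[n - 1] A := by
    rw [hBψ]
    refine euclideanHausdorffMeasure_image_le _ fun x hx y hy => ?_
    rw [dist_eq_norm, dist_eq_norm]
    exact (hlip x hx y hy).1
  have hHA : μHE[n - 1] A ≤ (c : ℝ≥0∞) ^ (n - 1) * μHE[n - 1] B := by
    rw [hBψ]
    refine euclideanHausdorffMeasure_le_image _ fun x hx y hy => ?_
    rw [dist_eq_norm, dist_eq_norm]
    have := (hlip x hx y hy).2
    rwa [inv_mul_le_iff₀ hc0'] at this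
  set CB : Set (E n) := {z : E n | 0 < inner ℝ z a ∧ inner ℝ z a ≤ h ∧
      (h / inner ℝ z a : ℝ) • z ∈ B} with hCB
  have hvol := volume_flatCone hn ha hh0 hBm fun b hb => hb.1
  have hA0 : (0 : E n) ∉ A := fun h => by simpa using hpos 0 h
  have hsub1 : radialProj K ⁻¹' A ∩ K ⊆ (c : ℝ) • CB := by
    rintro z ⟨hzA, hzK⟩
    rw [mem_smul_set_iff_inv_smul_mem₀ hc0'.ne']
    have hz0 : z ≠ 0 := by
      rintro rfl
      rw [mem_preimage, radialProj_zero] at hzA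
      exact hA0 hzA
    have hg := gauge_pos_of_ne_zero hc h0 hz0
    have hg1 := (mem_iff_gauge_le_one hc hK h0).1 hzK
    have hzx := gauge_smul_radialProj hc h0 z
    set x := radialProj K z
    have hp := hpos x hzA
    have hi : inner ℝ ((c : ℝ)⁻¹ • z) a = (c : ℝ)⁻¹ * (gauge K z * inner ℝ x a) := by
      conv_lhs => rw [← hzx]
      simp only [inner_smul_left, conj_trivial]
    have hip : 0 < inner ℝ ((c : ℝ)⁻¹ • z) a := by rw [hi]; positivity
    refine ⟨hip, ?_, ?_, ?_⟩
    · rw [hi, inv_mul_le_iff₀ hc0']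
      have := (hbd x hzA).2
      nlinarith
    · rw [inner_smul_left, conj_trivial]
      exact div_mul_cancel₀ h hip.ne'
    · rw [radialProj_smul (div_pos hh0 hip), radialProj_smul (inv_pos.2 hc0')]
      exact hzA
  have hsub2 : CB ⊆ (c : ℝ) • (radialProj K ⁻¹' A ∩ K) := by
    rintro z ⟨hz1, hz2, -, hz4⟩
    rw [mem_smul_set_iff_inv_smul_mem₀ hc0'.ne']
    rw [radialProj_smul (div_pos hh0 hz1)] at hz4
    refine ⟨?_, ?_⟩
    · rw [mem_preimage, radialProj_smul (inv_pos.2 hc0')]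
      exact hz4
    · rw [mem_iff_gauge_le_one hc hK h0, gauge_smul_pos (inv_nonneg.2 hc0'.le),
        inv_mul_le_iff₀ hc0', mul_one]
      have hzx := gauge_smul_radialProj hc h0 z
      set x := radialProj K z
      have hp := hpos x hz4
      have hi : inner ℝ z a = gauge K z * inner ℝ x a := by
        conv_lhs => rw [← hzx]
        simp only [inner_smul_left, conj_trivial]
      rw [hi] at hz2
      rw [← le_div_iff₀ hp] at hz2
      exact hz2.trans (hbd x hz4).1
  have hv1 := volume_le_of_subset_smul _ _ hsub1
  have hv2 := volume_le_of_subset_smul _ _ hsub2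
  rw [coneMeasure_apply hK h0 hA]
  constructor
  · calc (n : ℝ≥0∞) * volume (radialProj K ⁻¹' A ∩ K)
        ≤ n * ((c : ℝ≥0∞) ^ n * volume CB) := by gcongr
      _ = (c : ℝ≥0∞) ^ n * (ENNReal.ofReal h * μHE[n - 1] B) := by rw [← hvol]; ring
      _ ≤ _ := by gcongr
  · calc ENNReal.ofReal h * μHE[n - 1] A
        ≤ ENNReal.ofReal h * ((c : ℝ≥0∞) ^ (n - 1) * μHE[n - 1] B) := by gcongr
      _ = (c : ℝ≥0∞) ^ (n - 1) * (n * volume CB) := by rw [hvol]; ring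
      _ ≤ (c : ℝ≥0∞) ^ (n - 1) * (n * ((c : ℝ≥0∞) ^ n *
          volume (radialProj K ⁻¹' A ∩ K))) := by gcongr
      _ = _ := by ring

/-- The upper bounds hold strictly at `ε = 0` and are continuous there, so they persist for small
positive `ε`. -/
lemma exists_patch_size {h R c : ℝ} (hh : 0 < h) (hc : 1 < c) :
    ∃ ε, 0 < ε ∧ ε < h ∧ h / (h - ε) + h * R * ε / (h - ε) ^ 2 ≤ c ∧
      c⁻¹ ≤ h / (h + ε) - h * R * ε / (h - ε) ^ 2 ∧ h + (R + 1) * ε ≤ c * h ∧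
      h ≤ c * (h - (R + 1) * ε) := by
  have e1 : ∀ᶠ ε in 𝓝 (0 : ℝ), ε < h := gt_mem_nhds hh
  have e2 : ∀ᶠ ε in 𝓝 (0 : ℝ), h / (h - ε) + h * R * ε / (h - ε) ^ 2 < c := by
    have : ContinuousAt (fun ε : ℝ => h / (h - ε) + h * R * ε / (h - ε) ^ 2) 0 := by
      fun_prop (disch := simp [hh.ne'])
    refine this.eventually_lt continuousAt_const ?_
    simpa [hh.ne'] using hc
  have e3 : ∀ᶠ ε in 𝓝 (0 : ℝ), c⁻¹ < h / (h + ε) - h * R * ε / (h - ε) ^ 2 := by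
    have : ContinuousAt (fun ε : ℝ => h / (h + ε) - h * R * ε / (h - ε) ^ 2) 0 := by
      fun_prop (disch := simp [hh.ne'])
    refine continuousAt_const.eventually_lt this ?_
    simpa [hh.ne'] using inv_lt_one_of_one_lt₀ hc
  have e4 : ∀ᶠ ε in 𝓝 (0 : ℝ), h + (R + 1) * ε < c * h := by
    refine ContinuousAt.eventually_lt (by fun_prop) (by fun_prop) ?_
    nlinarith
  have e5 : ∀ᶠ ε in 𝓝 (0 : ℝ), h < c * (h - (R + 1) * ε) := by
    refine ContinuousAt.eventually_lt (by fun_prop) (by fun_prop) ?_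
    nlinarith
  have e6 : ∀ᶠ ε in 𝓝[>] (0 : ℝ), 0 < ε := self_mem_nhdsWithin
  obtain ⟨ε, h6, h1, h2, h3, h4, h5⟩ := (e6.and (nhdsWithin_le_nhds
    (e1.and (e2.and (e3.and (e4.and e5)))))).exists
  exact ⟨ε, h6, h1, h2.le, h3.le, h4.le, h5.le⟩

lemma inner_normal_pos (h0 : (0 : E n) ∈ interior K) {x z : E n} (hz : IsOuterUnitNormal K x z) :
    0 < inner ℝ x z := by
  obtain ⟨r, hr, hball⟩ := Metric.mem_nhds_iff.1 (mem_interior_iff_mem_nhds.1 h0)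
  have := hz.2 ((r / 2) • z) (hball (by simp [norm_smul, hz.1, abs_of_pos hr, hr]))
  rw [inner_sub_left, inner_smul_left, real_inner_self_eq_norm_sq, hz.1] at this
  simp at this
  linarith

/-- If `μ ≤ ν` on each member of a countable cover, then `μ A ≤ ν A`. -/
lemma measure_le_of_countable_cover {X : Type*} [MeasurableSpace X] {μ ν : Measure X}
    {s : ℕ → Set X} (hs : ∀ i, MeasurableSet (s i)) {A : Set X} (hA : MeasurableSet A)
    (hAs : A ⊆ ⋃ i, s i) (h : ∀ i, ∀ B ⊆ s i, MeasurableSet B → μ B ≤ ν B) : μ A ≤ ν A := by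
  have hd : A = ⋃ i, A ∩ disjointed s i := by
    rw [← inter_iUnion, iUnion_disjointed, inter_eq_self_of_subset_left hAs]
  have hm : ∀ i, MeasurableSet (A ∩ disjointed s i) := fun i =>
    hA.inter (MeasurableSet.disjointed hs i)
  have hdis : Pairwise (Function.onFun Disjoint fun i => A ∩ disjointed s i) :=
    fun i j hij => (disjoint_disjointed s hij).mono inter_subset_right inter_subset_right
  rw [hd, measure_iUnion hdis hm, measure_iUnion hdis hm]
  exact ENNReal.tsum_le_tsum fun i =>
    h i _ (inter_subset_right.trans (disjointed_subset s i)) (hm i)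

/-- Countably many patches cover the boundary. The exponent `2 * n` collects `n` from the dilation
of volumes, `n - 1` from the distortion of surface area, and `1` from replacing the height `h` by
`⟨x, ν(x)⟩`. -/
lemma coneMeasure_bounds (hn : 1 ≤ n) (hc : IsCompact K) (hK : Convex ℝ K)
    (h0 : (0 : E n) ∈ interior K) {c : ℝ≥0} (hc1 : 1 < c) {A : Set (E n)} (hA : MeasurableSet A)
    (hAf : A ⊆ frontier K) :
    coneMeasure K A ≤ (c : ℝ≥0∞) ^ (2 * n) * ∫⁻ x in A, ENNReal.ofReal (inner ℝ x (gaussMap K x))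
      ∂(μHE[n - 1].restrict (frontier K)) ∧
    ∫⁻ x in A, ENNReal.ofReal (inner ℝ x (gaussMap K x)) ∂(μHE[n - 1].restrict (frontier K)) ≤
      (c : ℝ≥0∞) ^ (2 * n) * coneMeasure K A := by
  obtain ⟨R, hR⟩ := hc.isBounded.exists_norm_le
  have hR0 : 0 ≤ R := (norm_nonneg _).trans (hR 0 (interior_subset h0))
  have hint : (interior K).Nonempty := ⟨0, h0⟩
  set μ := μHE[n - 1].restrict (frontier K) with hμ
  set F : E n → ℝ≥0∞ := fun x => ENNReal.ofReal (inner ℝ x (gaussMap K x)) with hF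
  choose! ε hε0 hεh h1 h2 h3 h4 using fun (p : E n × E n) (hp : p ∈ normalPairs K) =>
    exists_patch_size (R := R) (inner_normal_pos h0 hp.2) (c := c) hc1
  obtain ⟨t, htN, ht, hcov⟩ := TopologicalSpace.countable_cover_nhdsWithin
    (s := normalPairs K) (f := fun p => Metric.closedBall p (ε p)) fun p hp =>
      mem_nhdsWithin_of_mem_nhds (Metric.closedBall_mem_nhds _ (hε0 p hp))
  rcases A.eq_empty_or_nonempty with rfl | ⟨x₁, hx₁⟩
  · simp
  have htne : t.Nonempty := by
    obtain ⟨z, hz⟩ := exists_normal_of_mem_frontier hK hint (hAf hx₁)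
    obtain ⟨p, hp, -⟩ := mem_iUnion₂.1 (hcov (show (x₁, z) ∈ normalPairs K from ⟨hAf hx₁, hz⟩))
    exact ⟨p, hp⟩
  obtain ⟨e, rfl⟩ := ht.exists_eq_range htne
  have heN : ∀ i, e i ∈ normalPairs K := fun i => htN (mem_range_self i)
  let s : ℕ → Set (E n) := fun i =>
    Prod.fst '' (normalPairs K ∩ Metric.closedBall (e i) (ε (e i)))
  have hsm : ∀ i, MeasurableSet (s i) := fun i =>
    (((isCompact_normalPairs hc).inter_right Metric.isClosed_closedBall).image
      continuous_fst).isClosed.measurableSet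
  have hAs : A ⊆ ⋃ i, s i := by
    intro x hx
    obtain ⟨z, hz⟩ := exists_normal_of_mem_frontier hK hint (hAf hx)
    have hxz : (x, z) ∈ normalPairs K := ⟨hAf hx, hz⟩
    obtain ⟨p, ⟨i, rfl⟩, hp⟩ := mem_iUnion₂.1 (hcov hxz)
    exact mem_iUnion.2 ⟨i, (x, z), ⟨hxz, hp⟩, rfl⟩
  have hspatch : ∀ i, s i ⊆ normalPatch K (e i).1 (e i).2 (ε (e i)) := by
    rintro i _ ⟨p, ⟨hpN, hp⟩, rfl⟩
    rw [Metric.mem_closedBall, Prod.dist_eq, max_le_iff, dist_eq_norm, dist_eq_norm] at hp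
    exact ⟨hpN.1, hp.1, p.2, hpN.2, hp.2⟩
  have hFb : ∀ i, ∀ B ⊆ s i, MeasurableSet B →
      ENNReal.ofReal (inner ℝ (e i).1 (e i).2) * μ B ≤ c * ∫⁻ x in B, F x ∂μ ∧
      ∫⁻ x in B, F x ∂μ ≤ c * (ENNReal.ofReal (inner ℝ (e i).1 (e i).2) * μ B) := by
    intro i B hB hBm
    set h := inner ℝ (e i).1 (e i).2 with hh
    have hae : ∀ᵐ x ∂(μ.restrict B), h ≤ c * inner ℝ x (gaussMap K x) ∧
        inner ℝ x (gaussMap K x) ≤ c * h := by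
      filter_upwards [ae_restrict_of_ae (s := B)
        (ae_frontier_normal_eq_gaussMap hc.isClosed hK hint), ae_restrict_mem hBm] with x hx hxB
      obtain ⟨hxf, hxd, z, hz, hza⟩ := hspatch i (hB hxB)
      rw [← hx.2 z hz]
      have hdiff : |inner ℝ x z - h| ≤ (R + 1) * ε (e i) := by
        have : inner ℝ x z - h = inner ℝ x (z - (e i).2) + inner ℝ (x - (e i).1) (e i).2 := by
          rw [inner_sub_right, inner_sub_left]; ring
        rw [this]
        refine (abs_add_le _ _).trans ?_
        have e1 := abs_real_inner_le_norm x (z - (e i).2)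
        have e2 := abs_real_inner_le_norm (x - (e i).1) (e i).2
        rw [(heN i).2.1, mul_one] at e2
        have e3 : ‖x‖ * ‖z - (e i).2‖ ≤ R * ε (e i) := by
          have := hR x (hc.isClosed.frontier_subset hxf)
          gcongr
        linarith
      obtain ⟨d1, d2⟩ := abs_le.1 hdiff
      have g3 := h3 (e i) (heN i)
      have g4 := h4 (e i) (heN i)
      constructor
      · refine g4.trans ?_
        gcongr
        linarith
      · linarith
    have hconst : ENNReal.ofReal h * μ B = ∫⁻ _ in B, ENNReal.ofReal h ∂μ := by
      rw [setLIntegral_const]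
    rw [hconst, ← lintegral_const_mul' _ _ (by simp), ← lintegral_const_mul' _ _ (by simp)]
    have hcc : (c : ℝ≥0∞) = ENNReal.ofReal c := (ENNReal.ofReal_coe_nnreal).symm
    constructor
    · refine lintegral_mono_ae (hae.mono fun x hx => ?_)
      rw [hF, hcc, ← ENNReal.ofReal_mul (by positivity)]
      exact ENNReal.ofReal_le_ofReal hx.1
    · refine lintegral_mono_ae (hae.mono fun x hx => ?_)
      rw [hF, hcc, ← ENNReal.ofReal_mul (by positivity)]
      exact ENNReal.ofReal_le_ofReal hx.2
  have hμB : ∀ i, ∀ B ⊆ s i, MeasurableSet B → μ B = μHE[n - 1] B := by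
    intro i B hB hBm
    rw [hμ, Measure.restrict_apply hBm, inter_eq_self_of_subset_left]
    exact fun x hx => (hspatch i (hB hx)).1
  have hcomp := fun i B (hB : B ⊆ s i) (hBm : MeasurableSet B) =>
    coneMeasure_comparable hn hc hK h0 (heN i).2.1 rfl (hεh _ (heN i)) (hε0 _ (heN i)).le hR
      (zero_lt_one.trans hc1) (h1 _ (heN i)) (h2 _ (heN i)) hBm (hB.trans (hspatch i))
  have hpow : (c : ℝ≥0∞) ^ n * (c : ℝ≥0∞) ^ (n - 1) * c = (c : ℝ≥0∞) ^ (2 * n) := by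
    rw [mul_assoc, ← pow_succ, Nat.sub_add_cancel hn, ← pow_add, two_mul]
  have hwd : ∀ {B : Set (E n)}, MeasurableSet B → μ.withDensity F B = ∫⁻ x in B, F x ∂μ :=
    fun hB => withDensity_apply _ hB
  constructor
  · have := measure_le_of_countable_cover (μ := coneMeasure K)
      (ν := (c : ℝ≥0∞) ^ (2 * n) • μ.withDensity F) hsm hA hAs fun i B hB hBm => by
        have k1 := (hcomp i B hB hBm).1
        have k2 := (hFb i B hB hBm).1
        rw [hμB i B hB hBm] at k2
        rw [Measure.smul_apply, hwd hBm, smul_eq_mul, ← hpow]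
        calc coneMeasure K B ≤ _ := k1
          _ = (c : ℝ≥0∞) ^ n * (c : ℝ≥0∞) ^ (n - 1) *
            (ENNReal.ofReal (inner ℝ (e i).1 (e i).2) * μHE[n - 1] B) := by ring
          _ ≤ (c : ℝ≥0∞) ^ n * (c : ℝ≥0∞) ^ (n - 1) * (c * ∫⁻ x in B, F x ∂μ) := by gcongr
          _ = _ := by ring
    rwa [Measure.smul_apply, hwd hA, smul_eq_mul] at this
  · have := measure_le_of_countable_cover (μ := μ.withDensity F)
      (ν := (c : ℝ≥0∞) ^ (2 * n) • coneMeasure K) hsm hA hAs fun i B hB hBm => by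
        have k1 := (hcomp i B hB hBm).2
        have k2 := (hFb i B hB hBm).2
        rw [hμB i B hB hBm] at k2
        rw [Measure.smul_apply, hwd hBm, smul_eq_mul, ← hpow]
        calc ∫⁻ x in B, F x ∂μ ≤ _ := k2
          _ ≤ c * ((c : ℝ≥0∞) ^ (n - 1) * ((c : ℝ≥0∞) ^ n * coneMeasure K B)) := by gcongr
          _ = _ := by ring
    rwa [Measure.smul_apply, hwd hA, smul_eq_mul] at this

/-- The cone measure has density `⟨x, ν(x)⟩` with respect to the surface measure. -/
theorem coneMeasure_eq_withDensity (hn : 1 ≤ n) (hc : IsCompact K) (hK : Convex ℝ K)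
    (h0 : (0 : E n) ∈ interior K) :
    coneMeasure K = (μHE[n - 1].restrict (frontier K)).withDensity
      fun x => ENNReal.ofReal (inner ℝ x (gaussMap K x)) := by
  set μ := μHE[n - 1].restrict (frontier K) with hμ
  set F : E n → ℝ≥0∞ := fun x => ENNReal.ofReal (inner ℝ x (gaussMap K x)) with hF
  have hfm : MeasurableSet (frontier K) := isClosed_frontier.measurableSet
  -- Letting `c` decrease to `1` turns the two-sided bounds into equality.
  have htend : ∀ X : ℝ≥0∞, Tendsto (fun c : ℝ≥0 => (c : ℝ≥0∞) ^ (2 * n) * X) (𝓝[>] 1)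
      (𝓝 (1 * X)) := by
    intro X
    refine ENNReal.Tendsto.mul_const ?_ (Or.inl one_ne_zero)
    have : Continuous fun c : ℝ≥0 => (c : ℝ≥0∞) ^ (2 * n) := by fun_prop
    simpa using (this.tendsto 1).mono_left nhdsWithin_le_nhds
  have key : ∀ A ⊆ frontier K, MeasurableSet A → coneMeasure K A = ∫⁻ x in A, F x ∂μ := by
    intro A hAf hA
    have hb : ∀ c : ℝ≥0, c ∈ Ioi (1 : ℝ≥0) → _ := fun c hc1 =>
      coneMeasure_bounds hn hc hK h0 hc1 hA hAf
    apply le_antisymm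
    · refine ge_of_tendsto (x := 𝓝[>] (1 : ℝ≥0)) (by simpa using htend (∫⁻ x in A, F x ∂μ)) ?_
      filter_upwards [self_mem_nhdsWithin] with c hc1 using (hb c hc1).1
    · refine ge_of_tendsto (x := 𝓝[>] (1 : ℝ≥0)) (by simpa using htend (coneMeasure K A)) ?_
      filter_upwards [self_mem_nhdsWithin] with c hc1 using (hb c hc1).2
  ext A hA
  rw [withDensity_apply _ hA, ← measure_inter_add_sdiff A hfm, key _ inter_subset_right
    (hA.inter hfm)]
  have hz : coneMeasure K (A \ frontier K) = 0 := by
    rw [coneMeasure_apply hK h0 (hA.diff hfm)]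
    -- Only the origin is not projected to the boundary, and it is a null set since `n ≥ 1`.
    have hsub : radialProj K ⁻¹' (A \ frontier K) ∩ K ⊆ {0} := by
      rintro z ⟨hz, -⟩
      by_contra hz0
      exact hz.2 (radialProj_mem_frontier hc hK h0 hz0)
    have : Nontrivial (E n) := by
      have : Nonempty (Fin n) := ⟨⟨0, hn⟩⟩
      infer_instance
    rw [measure_mono_null hsub (measure_singleton _), mul_zero]
  rw [hz, add_zero, hμ, Measure.restrict_restrict (hA.inter hfm), Measure.restrict_restrict hA,
    inter_assoc, inter_self]

end ConeMeasure

/-! ### Almost everywhere differentiability of convex functions. -/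

section Rademacher

variable {n : ℕ} {K : Set (E n)} {f : E n → ℝ}

lemma ae_differentiableAt_of_locallyLipschitzOn {U : Set (E n)} (hU : IsOpen U)
    (hf : LocallyLipschitzOn U f) : ∀ᵐ x, x ∈ U → DifferentiableAt ℝ f x := by
  choose! C t ht hC using fun x (hx : x ∈ U) => hf hx
  obtain ⟨s, hsU, hs, hcov⟩ := TopologicalSpace.countable_cover_nhdsWithin
    (s := U) (f := fun x => interior (t x)) fun x hx => by
      have := ht x hx
      rw [hU.nhdsWithin_eq hx] at this
      exact mem_nhdsWithin_of_mem_nhds (interior_mem_nhds.2 this)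
  have hae : ∀ᵐ y, ∀ x ∈ s, y ∈ interior (t x) →
      DifferentiableWithinAt ℝ f (interior (t x)) y := by
    rw [ae_ball_iff hs]
    intro x hx
    exact ((hC x (hsU hx)).mono interior_subset).ae_differentiableWithinAt_of_mem
  filter_upwards [hae] with y hy hyU
  obtain ⟨x, hx, hyx⟩ := mem_iUnion₂.1 (hcov hyU)
  exact (hy x hx hyx).differentiableAt (isOpen_interior.mem_nhds hyx)

/-- A convex function is differentiable at almost every point of its domain. -/
lemma ae_differentiableAt_of_convexOn (hf : ConvexOn ℝ K f) :
    ∀ᵐ x ∂(volume.restrict K), x ∈ interior K ∧ DifferentiableAt ℝ f x := by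
  have h1 : (interior K : Set (E n)) =ᵐ[volume] K := by
    rw [ae_eq_set]
    refine ⟨by simp [sdiff_eq_empty.2 interior_subset], ?_⟩
    refine measure_mono_null ?_ (hf.1.addHaar_frontier volume)
    exact sdiff_subset_sdiff_left subset_closure
  rw [← Measure.restrict_congr_set h1, ae_restrict_iff' isOpen_interior.measurableSet]
  filter_upwards [ae_differentiableAt_of_locallyLipschitzOn isOpen_interior
    hf.locallyLipschitzOn_interior] with x hx hxK using ⟨hxK, hx hxK⟩

end Rademacher

/-! ### One-dimensional integration with one-sided derivatives. -/

section OneDim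

/-- A nonnegative right derivative of a continuous function is automatically integrable, so it may
blow up at the endpoints. -/
lemma lintegral_Ioo_deriv_right {F F' : ℝ → ℝ} {R : ℝ} (hR : 0 ≤ R)
    (hcont : ContinuousOn F (Icc 0 R)) (hd : ∀ r ∈ Ioo 0 R, HasDerivWithinAt F (F' r) (Ioi r) r)
    (hnn : ∀ r ∈ Ioo 0 R, 0 ≤ F' r) :
    ∫⁻ r in Ioo 0 R, ENNReal.ofReal (F' r) = ENNReal.ofReal (F R - F 0) := by
  have hint : IntegrableOn F' (Ioc 0 R) :=
    intervalIntegral.integrableOn_deriv_right_of_nonneg hcont hd hnn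
  rw [← ofReal_integral_eq_lintegral_ofReal (hint.mono_set Ioo_subset_Ioc_self),
    ← integral_Ioc_eq_integral_Ioo, ← intervalIntegral.integral_of_le hR,
    intervalIntegral.integral_eq_sub_of_hasDeriv_right_of_le hR hcont hd
      ((intervalIntegrable_iff_integrableOn_Ioc_of_le hR).2 hint)]
  filter_upwards [ae_restrict_mem measurableSet_Ioo] with r hr using hnn r hr

lemma sub_le_mul_rightDeriv {g : ℝ → ℝ} {R r : ℝ} (hg : ConvexOn ℝ (Icc 0 R) g)
    (hr : r ∈ Ioo 0 R) : g r - g 0 ≤ r * derivWithin g (Ioi r) r := by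
  have hri : r ∈ interior (Icc 0 R) := by rwa [interior_Icc]
  have h1 := hg.slope_le_leftDeriv_of_mem_interior ⟨le_rfl, hr.1.le.trans hr.2.le⟩ hri hr.1
  have h2 := h1.trans (hg.leftDeriv_le_rightDeriv_of_mem_interior hri)
  rw [slope_def_field, sub_zero, div_le_iff₀ hr.1] at h2
  linarith

/-- Integration of `(rⁿ g)'` for a convex function `g`. -/
lemma lintegral_pow_mul_deriv {n : ℕ} (hn : 1 ≤ n) {g : ℝ → ℝ} {R M : ℝ} (hR : 0 ≤ R)
    (hg : ConvexOn ℝ (Icc 0 R) g) (hcont : ContinuousOn g (Icc 0 R))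
    (hnn : ∀ r ∈ Ioo 0 R, 0 ≤ n * g r + r * derivWithin g (Ioi r) r + M) :
    ∫⁻ r in Ioo 0 R, ENNReal.ofReal (r ^ (n - 1)) *
      ENNReal.ofReal (n * g r + r * derivWithin g (Ioi r) r + M) =
      ENNReal.ofReal (R ^ n * (g R + M / n)) := by
  have hn0 : (n : ℝ) ≠ 0 := by positivity
  -- The shift `M / n` of `g` adds exactly `M` to the second factor of the derivative, which makes
  -- it nonnegative.
  have key := lintegral_Ioo_deriv_right (F := fun r => r ^ n * (g r + M / n))
    (F' := fun r => r ^ (n - 1) * (n * g r + r * derivWithin g (Ioi r) r + M)) hR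
    ((continuous_pow n).continuousOn.mul (hcont.add continuousOn_const)) ?_ ?_
  · rw [zero_pow (by omega), zero_mul, sub_zero] at key
    rw [← key]
    refine setLIntegral_congr_fun measurableSet_Ioo fun r hr => ?_
    rw [ENNReal.ofReal_mul (pow_nonneg hr.1.le _)]
  · intro r hr
    have hri : r ∈ interior (Icc 0 R) := by rwa [interior_Icc]
    have h1 := hg.hasDerivWithinAt_rightDeriv_of_mem_interior hri
    have h2 := ((hasDerivAt_pow n r).hasDerivWithinAt (s := Ioi r)).mul (h1.add_const (M / n))
    refine h2.congr_deriv ?_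
    obtain ⟨m, rfl⟩ : ∃ m, n = m + 1 := ⟨n - 1, by omega⟩
    rw [Nat.add_sub_cancel, pow_succ]
    field_simp
    ring
  · intro r hr
    exact mul_nonneg (pow_nonneg hr.1.le _) (hnn r hr)

end OneDim

/-! ### Polar coordinates. -/

section Polar

variable {n : ℕ}

lemma lintegral_polar (hn : 1 ≤ n) {G : E n → ℝ≥0∞} (hG : AEMeasurable G) :
    ∫⁻ x, G x = ∫⁻ θ : Metric.sphere (0 : E n) 1, (∫⁻ r in Ioi (0 : ℝ),
      ENNReal.ofReal (r ^ (n - 1)) * G (r • θ.1)) ∂(volume : Measure (E n)).toSphere := by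
  have : Nonempty (Fin n) := ⟨⟨0, hn⟩⟩
  have hmp := (volume : Measure (E n)).measurePreserving_homeomorphUnitSphereProd
  set e := homeomorphUnitSphereProd (E n)
  have hmp' : MeasurePreserving e.symm _ _ := hmp.symm e.toMeasurableEquiv
  have hval : ∀ p, (e.symm p : E n) = p.2.1 • p.1.1 := fun p => by
    simp [e]
  have h1 : ∫⁻ x, G x = ∫⁻ x : ({0}ᶜ : Set (E n)), G x.1 ∂(volume.comap Subtype.val) := by
    rw [lintegral_subtype_comap (measurableSet_singleton _).compl]
    rw [restrict_compl_singleton]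
  have hG' : AEMeasurable (fun x : ({0}ᶜ : Set (E n)) => G x.1) (volume.comap Subtype.val) := by
    refine AEMeasurable.comp_quasiMeasurePreserving (g := G) (f := Subtype.val) hG ?_
    refine ⟨measurable_subtype_coe, ?_⟩
    rw [map_comap_subtype_coe (measurableSet_singleton _).compl]
    exact Measure.restrict_le_self.absolutelyContinuous
  rw [h1, ← hmp'.lintegral_comp_emb e.symm.measurableEmbedding, lintegral_prod]
  · refine lintegral_congr fun θ => ?_
    rw [Measure.volumeIoiPow, lintegral_withDensity_eq_lintegral_mul_non_measurable _
      (by fun_prop) (by simp)]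
    simp only [Pi.mul_apply, hval, finrank_euclideanSpace_fin]
    exact lintegral_subtype_comap measurableSet_Ioi
      (fun r : ℝ => ENNReal.ofReal (r ^ (n - 1)) * G (r • θ.1))
  · exact hG'.comp_quasiMeasurePreserving hmp'.quasiMeasurePreserving

end Polar

/-! ### The divergence theorem with the origin in the interior. -/

section Rays

variable {n : ℕ} {K : Set (E n)} {f : E n → ℝ} {C : ℝ}

lemma measurable_fderiv_apply_self (f : E n → ℝ) : Measurable fun x => fderiv ℝ f x x :=
  isBoundedBilinearMap_apply.continuous.measurable.comp
    ((measurable_fderiv ℝ f).prodMk measurable_id)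

/-- The one-sided derivative of `f` in the radial direction. -/
def radialDeriv (f : E n → ℝ) (x : E n) : ℝ := derivWithin (fun t : ℝ => f (t • x)) (Ioi 1) 1

lemma radialDeriv_eq_fderiv {x : E n} (hx : DifferentiableAt ℝ f x) :
    radialDeriv f x = fderiv ℝ f x x := by
  have h1 : HasDerivAt (fun t : ℝ => t • x) x 1 := by
    simpa using (hasDerivAt_id (1 : ℝ)).smul_const x
  have h2 : HasFDerivAt f (fderiv ℝ f x) ((1 : ℝ) • x) := by
    rw [one_smul]; exact hx.hasFDerivAt
  exact (h2.comp_hasDerivAt 1 h1).hasDerivWithinAt.derivWithin (uniqueDiffWithinAt_Ioi 1)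

lemma radialDeriv_smul {x : E n} {r : ℝ} (hr : 0 < r)
    (hd : DifferentiableWithinAt ℝ (fun t : ℝ => f (t • x)) (Ioi r) r) :
    radialDeriv f (r • x) = r * derivWithin (fun t : ℝ => f (t • x)) (Ioi r) r := by
  have h1 : HasDerivWithinAt (fun t : ℝ => t * r) r (Ioi 1) 1 := by
    simpa using (hasDerivWithinAt_id (1 : ℝ) (Ioi 1)).mul_const r
  have hd' : HasDerivWithinAt (fun t : ℝ => f (t • x))
      (derivWithin (fun t : ℝ => f (t • x)) (Ioi r) r) (Ioi r) (1 * r) := by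
    rw [one_mul]; exact hd.hasDerivWithinAt
  have h2 := hd'.comp (1 : ℝ) h1 fun t (ht : 1 < t) => by
    show r < t * r
    nlinarith
  have h3 := h2.derivWithin (uniqueDiffWithinAt_Ioi 1)
  rw [radialDeriv, mul_comm, ← h3]
  congr 1
  ext t
  simp [smul_smul]

/-- Only the endpoint `R` needs care: lower semicontinuity bounds `f` from below there, and
convexity along the segment from `0` bounds it from above. -/
lemma radial_continuousOn (hK : Convex ℝ K) (h0 : (0 : E n) ∈ interior K)
    (hf : ConvexOn ℝ K f) (hlsc : LowerSemicontinuousOn f K) {x : E n} {R : ℝ} (hR : 0 < R)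
    (hx : R • x ∈ K) : ContinuousOn (fun r : ℝ => f (r • x)) (Icc 0 R) := by
  have hfc : ContinuousOn f (interior K) := hf.continuousOn_interior
  have hmem : ∀ r ∈ Icc 0 R, r • x ∈ K := by
    intro r hr
    have h1 := hK.smul_mem_of_zero_mem (interior_subset h0) hx
      (t := r / R) ⟨div_nonneg hr.1 hR.le, (div_le_one hR).2 hr.2⟩
    rwa [smul_smul, div_mul_cancel₀ _ hR.ne'] at h1
  have hmem' : ∀ r ∈ Ico 0 R, r • x ∈ interior K := by
    intro r hr
    have h1 := hK.combo_interior_self_mem_interior h0 hx (a := 1 - r / R) (b := r / R)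
      (by rw [sub_pos]; exact (div_lt_one hR).2 hr.2) (div_nonneg hr.1 hR.le) (by ring)
    rwa [smul_zero, zero_add, smul_smul, div_mul_cancel₀ _ hR.ne'] at h1
  intro r hr
  rcases hr.2.lt_or_eq with hlt | rfl
  · have h1 : ContinuousAt f (r • x) :=
      hfc.continuousAt (isOpen_interior.mem_nhds (hmem' r ⟨hr.1, hlt⟩))
    have h2 : ContinuousAt (fun r : ℝ => r • x) r := by fun_prop
    exact (ContinuousAt.comp (g := f) (f := fun r : ℝ => r • x) h1 h2).continuousWithinAt
  · refine tendsto_order.2 ⟨fun y hy => ?_, fun y hy => ?_⟩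
    · have h1 : Tendsto (fun s : ℝ => s • x) (𝓝[Icc 0 r] r) (𝓝[K] (r • x)) :=
        tendsto_nhdsWithin_iff.2 ⟨((by fun_prop : Continuous fun s : ℝ => s • x).tendsto
          r).mono_left nhdsWithin_le_nhds, by
            filter_upwards [self_mem_nhdsWithin] with s hs using hmem s hs⟩
      exact h1.eventually (hlsc _ hx y hy)
    · have h1 : Tendsto (fun s : ℝ => (1 - s / r) * f 0 + s / r * f (r • x)) (𝓝[Icc 0 r] r)
          (𝓝 (f (r • x))) := by
        have : ContinuousAt (fun s : ℝ => (1 - s / r) * f 0 + s / r * f (r • x)) r := by fun_prop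
        have := this.tendsto.mono_left (nhdsWithin_le_nhds (s := Icc 0 r))
        simpa [hR.ne'] using this
      filter_upwards [h1.eventually (gt_mem_nhds hy), self_mem_nhdsWithin] with s hs hs'
      refine lt_of_le_of_lt ?_ hs
      have h2 := hf.2 (interior_subset h0) hx (show 0 ≤ 1 - s / r by rw [sub_nonneg]; exact (div_le_one hR).2 hs'.2)
        (div_nonneg hs'.1 hR.le) (by ring)
      rwa [smul_zero, zero_add, smul_smul, div_mul_cancel₀ _ hR.ne'] at h2

lemma lintegral_ray (hc : IsCompact K) (hK : Convex ℝ K) (h0 : (0 : E n) ∈ interior K)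
    (G : E n → ℝ≥0∞) {θ : E n} (hθ : θ ≠ 0) :
    ∫⁻ r in Ioi (0 : ℝ), ENNReal.ofReal (r ^ (n - 1)) * K.indicator G (r • θ) =
      ∫⁻ r in Ioo (0 : ℝ) (gauge K θ)⁻¹, ENNReal.ofReal (r ^ (n - 1)) * G (r • θ) := by
  have hg := gauge_pos_of_ne_zero hc h0 hθ
  have h1 : ∫⁻ r in Ioi (0 : ℝ), ENNReal.ofReal (r ^ (n - 1)) * K.indicator G (r • θ) =
      ∫⁻ r in Ioi (0 : ℝ), (Ioc 0 (gauge K θ)⁻¹).indicator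
        (fun r => ENNReal.ofReal (r ^ (n - 1)) * G (r • θ)) r := by
    refine setLIntegral_congr_fun measurableSet_Ioi fun r (hr : 0 < r) => ?_
    have hiff : r • θ ∈ K ↔ r ∈ Ioc 0 (gauge K θ)⁻¹ := by
      rw [mem_iff_gauge_le_one hc hK h0, gauge_smul_pos hr.le, mem_Ioc, ← one_div,
        le_div_iff₀ hg]
      exact ⟨fun h => ⟨hr, h⟩, fun h => h.2⟩
    by_cases h : r • θ ∈ K
    · simp only [indicator_of_mem h, indicator_of_mem (hiff.1 h)]
    · simp only [indicator_of_notMem h, indicator_of_notMem (fun h' => h (hiff.2 h')), mul_zero]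
  rw [h1, lintegral_indicator measurableSet_Ioc, Measure.restrict_restrict measurableSet_Ioc,
    inter_eq_self_of_subset_left Ioc_subset_Ioi_self, restrict_Ioo_eq_restrict_Ioc]

/-- Partial integration along rays. -/
lemma lintegral_radialDeriv (hn : 1 ≤ n) (hc : IsCompact K) (hK : Convex ℝ K)
    (h0 : (0 : E n) ∈ interior K) (hfm : Measurable f) (hf : ConvexOn ℝ K f)
    (hlsc : LowerSemicontinuousOn f K) (hC : ∀ x ∈ K, |f x| ≤ C) :
    ∫⁻ x in K, ENNReal.ofReal (n * f x + fderiv ℝ f x x + (n + 2) * C) =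
      ∫⁻ x in K, ENNReal.ofReal (n * f (radialProj K x) + (n + 2) * C) ∧
    ∀ᵐ x ∂(volume.restrict K), 0 ≤ n * f x + fderiv ℝ f x x + (n + 2) * C := by
  have hKm := hc.isClosed.measurableSet
  have hn0 : (0 : ℝ) < n := by exact_mod_cast hn
  -- `n * f ≥ -n * C`, and by convexity the radial derivative at `r • x` is at least `f (r • x) - f
  -- 0 ≥ -2 * C`, so this `M` makes the integrand nonnegative.
  set M : ℝ := (n + 2) * C with hM
  -- The one-sided derivative exists at every interior point of every ray, so replacing `fderiv` by
  -- it avoids exceptional rays.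
  have hae : ∀ᵐ x ∂(volume.restrict K), x ∈ interior K ∧ radialDeriv f x = fderiv ℝ f x x :=
    (ae_differentiableAt_of_convexOn hf).mono fun x hx => ⟨hx.1, radialDeriv_eq_fderiv hx.2⟩
  have hfd : Measurable fun x => fderiv ℝ f x x := measurable_fderiv_apply_self f
  have hmeas : AEMeasurable (fun x => ENNReal.ofReal (n * f x + radialDeriv f x + M))
      (volume.restrict K) := by
    refine AEMeasurable.congr (f := fun x => ENNReal.ofReal (n * f x + fderiv ℝ f x x + M)) ?_ ?_
    · exact (((hfm.const_mul _).add hfd).add_const M).ennreal_ofReal.aemeasurable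
    · filter_upwards [hae] with x hx
      rw [hx.2]
  have hconv : ∀ (x : E n) (R : ℝ), 0 < R → R • x ∈ K →
      ConvexOn ℝ (Icc 0 R) fun r : ℝ => f (r • x) := by
    intro x R hR hx
    have h1 := hf.comp_linearMap (LinearMap.toSpanSingleton ℝ (E n) x)
    refine h1.subset (fun r hr => ?_) (convex_Icc 0 R)
    have h2 := hK.smul_mem_of_zero_mem (interior_subset h0) hx
      (t := r / R) ⟨div_nonneg hr.1 hR.le, (div_le_one hR).2 hr.2⟩
    rw [smul_smul, div_mul_cancel₀ _ hR.ne'] at h2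
    exact h2
  have hbound : ∀ (x : E n) (R : ℝ), 0 < R → R • x ∈ K → ∀ r ∈ Ioo 0 R,
      r • x ∈ K ∧ 0 ≤ n * f (r • x) + r * derivWithin (fun r : ℝ => f (r • x)) (Ioi r) r + M := by
    intro x R hR hx r hr
    have hrx : r • x ∈ K := by
      have h2 := hK.smul_mem_of_zero_mem (interior_subset h0) hx
        (t := r / R) ⟨div_nonneg hr.1.le hR.le, (div_le_one hR).2 hr.2.le⟩
      rwa [smul_smul, div_mul_cancel₀ _ hR.ne'] at h2
    refine ⟨hrx, ?_⟩
    have h3 := sub_le_mul_rightDeriv (hconv x R hR hx) hr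
    have h4 := (abs_le.1 (hC _ hrx)).1
    have h5 := (abs_le.1 (hC _ (interior_subset h0))).2
    simp only [zero_smul] at h3
    rw [hM]
    nlinarith
  have hR : ∀ θ : E n, θ ≠ 0 → 0 < (gauge K θ)⁻¹ ∧ (gauge K θ)⁻¹ • θ ∈ K := fun θ hθ =>
    ⟨inv_pos.2 (gauge_pos_of_ne_zero hc h0 hθ),
      hc.isClosed.frontier_subset (radialProj_mem_frontier hc hK h0 hθ)⟩
  have hdiff : ∀ (x : E n) (R : ℝ), 0 < R → R • x ∈ K → ∀ r ∈ Ioo 0 R,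
      radialDeriv f (r • x) = r * derivWithin (fun r : ℝ => f (r • x)) (Ioi r) r := by
    intro x R hR hx r hr
    refine radialDeriv_smul hr.1
      ((hconv x R hR hx).differentiableWithinAt_Ioi_of_mem_interior ?_)
    rwa [interior_Icc]
  have hqm : Measurable fun x => ENNReal.ofReal (n * f (radialProj K x) + M) :=
    (((hfm.comp (measurable_radialProj hK h0)).const_mul _).add_const M).ennreal_ofReal
  constructor
  · have e1 : ∫⁻ x in K, ENNReal.ofReal (n * f x + fderiv ℝ f x x + M) =
        ∫⁻ x in K, ENNReal.ofReal (n * f x + radialDeriv f x + M) :=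
      lintegral_congr_ae (hae.mono fun x hx => by simp only [hx.2])
    rw [e1, ← lintegral_indicator hKm, ← lintegral_indicator hKm,
      lintegral_polar hn ((aemeasurable_indicator_iff hKm).2 hmeas),
      lintegral_polar hn (hqm.indicator hKm).aemeasurable]
    refine lintegral_congr fun θ => ?_
    have hθ : θ.1 ≠ 0 := by
      intro h
      have := θ.2
      rw [h] at this
      simp at this
    obtain ⟨hR0, hRK⟩ := hR θ.1 hθ
    rw [lintegral_ray hc hK h0 _ hθ, lintegral_ray hc hK h0 _ hθ]
    have k1 := lintegral_pow_mul_deriv hn (M := M) hR0.le (hconv θ.1 _ hR0 hRK)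
      (radial_continuousOn hK h0 hf hlsc hR0 hRK)
      fun r hr => (hbound θ.1 _ hR0 hRK r hr).2
    -- The ray integral depends only on the endpoint value, so the constant function with that value
    -- has the same one.
    have k2 := lintegral_pow_mul_deriv hn (M := M) (g := fun _ => f ((gauge K θ.1)⁻¹ • θ.1))
      hR0.le (convexOn_const _ (convex_Icc _ _)) continuousOn_const fun r hr => by
        have h4 := (abs_le.1 (hC _ hRK)).1
        have h5 := (abs_nonneg _).trans (hC _ hRK)
        simp only [derivWithin_fun_const, Pi.zero_apply, mul_zero]
        rw [hM]
        nlinarith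
    refine Eq.trans ?_ (k1.trans (k2.symm.trans ?_))
    · refine setLIntegral_congr_fun measurableSet_Ioo fun r hr => ?_
      simp only [hdiff θ.1 _ hR0 hRK r hr]
    · refine setLIntegral_congr_fun measurableSet_Ioo fun r hr => ?_
      simp only [derivWithin_fun_const, Pi.zero_apply, mul_zero, add_zero, radialProj_smul hr.1]
      rfl
  · have hne : ∀ᵐ x : E n ∂(volume.restrict K), x ≠ 0 := by
      have : Nonempty (Fin n) := ⟨⟨0, hn⟩⟩
      refine ae_restrict_of_ae ?_
      simp [ae_iff, measure_singleton]
    filter_upwards [hae, hne] with x hx hx0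
    have hg1 := (gauge_lt_one_iff_mem_interior hK (mem_interior_iff_mem_nhds.1 h0)).2 hx.1
    obtain ⟨hR0, hRK⟩ := hR x hx0
    have h1 : (1 : ℝ) ∈ Ioo 0 (gauge K x)⁻¹ :=
      ⟨one_pos, (one_lt_inv₀ (gauge_pos_of_ne_zero hc h0 hx0)).2 hg1⟩
    have h2 := (hbound x _ hR0 hRK 1 h1).2
    rw [← hdiff x _ hR0 hRK 1 h1, one_smul, hx.2] at h2
    exact h2

/-- The divergence theorem for the vector field `f(x) x` on a convex body. -/
theorem integral_radial (hn : 1 ≤ n) (hc : IsCompact K) (hK : Convex ℝ K)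
    (h0 : (0 : E n) ∈ interior K) (hfm : Measurable f) (hf : ConvexOn ℝ K f)
    (hlsc : LowerSemicontinuousOn f K) (hC : ∀ x ∈ K, |f x| ≤ C) :
    IntegrableOn (fun x => fderiv ℝ f x x) K ∧
    ∫ x in K, (n * f x + fderiv ℝ f x x) =
      ∫ x in frontier K, f x * inner ℝ x (gaussMap K x) ∂μHE[n - 1] := by
  obtain ⟨h1, h2⟩ := lintegral_radialDeriv hn hc hK h0 hfm hf hlsc hC
  have hKm := hc.isClosed.measurableSet
  have hfin : IsFiniteMeasure (volume.restrict K) := ⟨by simpa using hc.measure_lt_top⟩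
  set M : ℝ := (n + 2) * C with hM
  have hfd : Measurable fun x => fderiv ℝ f x x := measurable_fderiv_apply_self f
  have hne : ∀ᵐ x : E n ∂(volume.restrict K), x ≠ 0 := by
    have : Nonempty (Fin n) := ⟨⟨0, hn⟩⟩
    refine ae_restrict_of_ae ?_
    simp [ae_iff, measure_singleton]
  have hqm := measurable_radialProj hK h0
  have hqC : ∀ᵐ x ∂(volume.restrict K), |f (radialProj K x)| ≤ C := hne.mono fun x hx =>
    hC _ (hc.isClosed.frontier_subset (radialProj_mem_frontier hc hK h0 hx))
  have hqi : Integrable (fun x => f (radialProj K x)) (volume.restrict K) :=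
    Integrable.of_bound (hfm.comp hqm).aestronglyMeasurable C hqC
  have hq0 : ∀ᵐ x ∂(volume.restrict K), 0 ≤ n * f (radialProj K x) + M := by
    filter_upwards [hqC] with x hx
    have h4 := (abs_le.1 hx).1
    have h5 := (abs_nonneg _).trans hx
    rw [hM]
    have : (0 : ℝ) ≤ n := by positivity
    nlinarith
  have hqi' : Integrable (fun x => n * f (radialProj K x) + M) (volume.restrict K) :=
    (hqi.const_mul _).add (integrable_const _)
  have hfi : Integrable f (volume.restrict K) :=
    Integrable.of_bound hfm.aestronglyMeasurable C
      ((ae_restrict_mem hKm).mono fun x hx => hC x hx)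
  have hgm : AEStronglyMeasurable (fun x => n * f x + fderiv ℝ f x x + M) (volume.restrict K) :=
    (((hfm.const_mul _).add hfd).add_const M).aestronglyMeasurable
  -- Integrability comes from the equality of lower integrals: the other integrand is bounded almost
  -- everywhere.
  have hgi : Integrable (fun x => n * f x + fderiv ℝ f x x + M) (volume.restrict K) := by
    rw [← lintegral_ofReal_ne_top_iff_integrable hgm h2, h1]
    exact (lintegral_ofReal_ne_top_iff_integrable hqi'.aestronglyMeasurable hq0).2 hqi'
  have heq : ∫ x in K, (n * f x + fderiv ℝ f x x + M) =
      ∫ x in K, (n * f (radialProj K x) + M) := by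
    rw [integral_eq_lintegral_of_nonneg_ae h2 hgm,
      integral_eq_lintegral_of_nonneg_ae hq0 hqi'.aestronglyMeasurable, h1]
  have hgi' : Integrable (fun x => n * f x + fderiv ℝ f x x) (volume.restrict K) := by
    refine (hgi.sub (integrable_const M)).congr (Eventually.of_forall fun x => ?_)
    simp
  constructor
  · have := hgi'.sub (hfi.const_mul (n : ℝ))
    refine this.congr (Eventually.of_forall fun x => ?_)
    simp
  · rw [integral_add hgi' (integrable_const _), integral_add (hqi.const_mul _)
      (integrable_const _), add_left_inj] at heq
    rw [heq]
    have hcone : ∫ x, f x ∂(coneMeasure K) = ∫ x in K, n * f (radialProj K x) := by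
      rw [coneMeasure, integral_smul_measure, integral_map hqm.aemeasurable
        hfm.aestronglyMeasurable, integral_const_mul]
      simp
    have hden : AEMeasurable (fun x => (inner ℝ x (gaussMap K x)).toNNReal)
        (μHE[n - 1].restrict (frontier K)) :=
      (aemeasurable_id.inner (aemeasurable_gaussMap hc hK ⟨0, h0⟩)).real_toNNReal
    rw [← hcone, coneMeasure_eq_withDensity hn hc hK h0]
    change ∫ x, f x ∂((μHE[n - 1].restrict (frontier K)).withDensity
      fun x => ((inner ℝ x (gaussMap K x)).toNNReal : ℝ≥0∞)) = _
    rw [integral_withDensity_eq_integral_smul₀ hden]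
    refine integral_congr_ae ?_
    filter_upwards [ae_frontier_normal_eq_gaussMap hc.isClosed hK ⟨0, h0⟩] with x hx
    rw [NNReal.smul_def, Real.coe_toNNReal _ (inner_normal_pos h0 hx.1).le, smul_eq_mul, mul_comm]

end Rays

/-! ### Removing the condition on the origin. -/

section Translation

variable {n : ℕ} {K : Set (E n)} {f : E n → ℝ} {C : ℝ}

lemma gaussMap_preimage_add (a y : E n) :
    gaussMap ((fun y => y + a) ⁻¹' K) y = gaussMap K (y + a) := by
  have h : IsOuterUnitNormal ((fun y => y + a) ⁻¹' K) y = IsOuterUnitNormal K (y + a) := by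
    funext z
    refine propext (and_congr_right fun _ => ⟨fun h w hw => ?_, fun h w hw => ?_⟩)
    · have := h (w - a) (by simpa using hw)
      rwa [sub_sub, add_comm a y] at this
    · have := h (w + a) hw
      rwa [add_sub_add_right_eq_sub] at this
  unfold gaussMap
  rw [h]

/-- The divergence theorem for the vector field `f(x) (x - a)`, where `a` is an interior point. -/
theorem integral_radial_center (hn : 1 ≤ n) (hc : IsCompact K) {a : E n}
    (ha : a ∈ interior K) (hfm : Measurable f) (hf : ConvexOn ℝ K f)
    (hlsc : LowerSemicontinuousOn f K) (hC : ∀ x ∈ K, |f x| ≤ C) :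
    IntegrableOn (fun x => fderiv ℝ f x (x - a)) K ∧
    ∫ x in K, (n * f x + fderiv ℝ f x (x - a)) =
      ∫ x in frontier K, f x * inner ℝ (x - a) (gaussMap K x) ∂μHE[n - 1] := by
  let e := IsometryEquiv.addRight a
  have he : (e : E n → E n) = fun y => y + a := rfl
  have hint : interior (e ⁻¹' K) = e ⁻¹' interior K := (e.toHomeomorph.preimage_interior K).symm
  have hfr : frontier (e ⁻¹' K) = e ⁻¹' frontier K := (e.toHomeomorph.preimage_frontier K).symm
  have hemb : MeasurableEmbedding e := e.toHomeomorph.measurableEmbedding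
  have hmp : MeasurePreserving e volume volume := measurePreserving_add_right volume a
  have hmpH : MeasurePreserving e μHE[n - 1] μHE[n - 1] :=
    e.measurePreserving_euclideanHausdorffMeasure (n - 1)
  have hf' : ConvexOn ℝ (e ⁻¹' K) fun y => f (y + a) := by
    have h := hf.translate_left a
    simp only [add_comm a] at h
    exact h
  have key := integral_radial (K := e ⁻¹' K) (f := fun y => f (y + a)) (C := C) hn
    (e.toHomeomorph.isCompact_preimage.2 hc) hf'.1
    (by rw [hint]; simpa [he] using ha) (hfm.comp (measurable_add_const a)) hf'
    (hlsc.comp (t := e ⁻¹' K) (g := e) e.continuous.continuousOn fun y hy => hy)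
    fun y hy => hC _ hy
  obtain ⟨k1, k2⟩ := key
  simp only [fderiv_comp_add_right] at k1 k2
  constructor
  · rw [← hmp.integrableOn_comp_preimage hemb]
    refine k1.congr (Eventually.of_forall fun y => ?_)
    simp [he]
  · rw [← hmp.setIntegral_preimage_emb hemb, ← hmpH.setIntegral_preimage_emb hemb]
    rw [hfr] at k2
    refine Eq.trans ?_ (k2.trans ?_)
    · simp [he]
    · simp only [he, gaussMap_preimage_add, add_sub_cancel_right]

lemma measure_frontier_lt_top (hc : IsCompact K)
    (h : ∀ x ∈ frontier K, ∃ z, IsOuterUnitNormal K x z) : μHE[n - 1] (frontier K) < ⊤ :=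
  (measure_mono (t := {x ∈ K | ∃ z, IsOuterUnitNormal K x z}) fun x hx => ⟨hc.isClosed.frontier_subset hx, h x hx⟩).trans_lt
    (measure_hasNormal_lt_top hc.isBounded)

lemma integrableOn_frontier_mul_inner (hc : IsCompact K) (hK : Convex ℝ K)
    (hint : (interior K).Nonempty) (hfm : Measurable f) (hC : ∀ x ∈ K, |f x| ≤ C) (a : E n) :
    IntegrableOn (fun x => f x * inner ℝ (x - a) (gaussMap K x)) (frontier K) μHE[n - 1] := by
  have hfin : IsFiniteMeasure (μHE[n - 1].restrict (frontier K)) :=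
    ⟨by
      rw [Measure.restrict_apply_univ]
      exact measure_frontier_lt_top hc fun x hx => exists_normal_of_mem_frontier hK hint hx⟩
  obtain ⟨R, hR⟩ := hc.isBounded.exists_norm_le
  refine Integrable.of_bound (C := C * (R + ‖a‖)) ?_ ?_
  · exact (hfm.aemeasurable.mul ((aemeasurable_id.sub_const a).inner
      (aemeasurable_gaussMap hc hK hint))).aestronglyMeasurable
  · filter_upwards [ae_restrict_mem isClosed_frontier.measurableSet] with x hx
    have hxK := hc.isClosed.frontier_subset hx
    have h1 := hC x hxK
    have h2 : |inner ℝ (x - a) (gaussMap K x)| ≤ R + ‖a‖ := by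
      refine (abs_real_inner_le_norm _ _).trans ?_
      calc ‖x - a‖ * ‖gaussMap K x‖ ≤ (‖x‖ + ‖a‖) * 1 := by
            gcongr
            · exact norm_sub_le _ _
            · exact norm_gaussMap_le x
        _ ≤ R + ‖a‖ := by linarith [hR x hxK]
    rw [norm_mul, Real.norm_eq_abs, Real.norm_eq_abs]
    have := (abs_nonneg _).trans h1
    gcongr

/-- The divergence theorem for the vector field `f(x) x`, without a condition on the position of
the origin. -/
theorem integral_divergence (hn : 1 ≤ n) (hc : IsCompact K) (hK : Convex ℝ K)
    (hint : (interior K).Nonempty) (hfm : Measurable f) (hf : ConvexOn ℝ K f)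
    (hlsc : LowerSemicontinuousOn f K) (hC : ∀ x ∈ K, |f x| ≤ C) :
    IntegrableOn (fun x => fderiv ℝ f x x) K ∧
    ∫ x in K, (n * f x + fderiv ℝ f x x) =
      ∫ x in frontier K, f x * inner ℝ x (gaussMap K x) ∂μHE[n - 1] := by
  obtain ⟨a, ha⟩ := hint
  -- With two interior centres `a` and `(1 + s) a`, the field `x` is the combination `(1 + s⁻¹)(x -
  -- a) - s⁻¹(x - (1 + s) a)`, and the identity is linear in the field.
  obtain ⟨s, hs, hs'⟩ : ∃ s : ℝ, 0 < s ∧ a + s • a ∈ interior K := by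
    have h1 : Tendsto (fun s : ℝ => a + s • a) (𝓝[>] 0) (𝓝 a) := by
      have : Continuous fun s : ℝ => a + s • a := by fun_prop
      simpa using (this.tendsto 0).mono_left (nhdsWithin_le_nhds (s := Ioi 0))
    obtain ⟨s, h2, h3⟩ := ((h1.eventually (isOpen_interior.mem_nhds ha)).and
      self_mem_nhdsWithin).exists
    exact ⟨s, h3, h2⟩
  obtain ⟨i0, e0⟩ := integral_radial_center hn hc ha hfm hf hlsc hC
  obtain ⟨i1, e1⟩ := integral_radial_center hn hc hs' hfm hf hlsc hC
  have j0 := integrableOn_frontier_mul_inner hc hK ⟨a, ha⟩ hfm hC a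
  have j1 := integrableOn_frontier_mul_inner hc hK ⟨a, ha⟩ hfm hC (a + s • a)
  have hfin : IsFiniteMeasure (volume.restrict K) := ⟨by simpa using hc.measure_lt_top⟩
  have hfi : Integrable (fun x => n * f x) (volume.restrict K) :=
    (Integrable.of_bound hfm.aestronglyMeasurable C
      ((ae_restrict_mem hc.isClosed.measurableSet).mono fun x hx => hC x hx)).const_mul _
  have hd : ∀ x, fderiv ℝ f x x = (1 + s⁻¹) * fderiv ℝ f x (x - a) -
      s⁻¹ * fderiv ℝ f x (x - (a + s • a)) := by
    intro x
    simp only [map_sub, map_add, map_smul, smul_eq_mul]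
    field_simp
    ring
  have hg : ∀ x, f x * inner ℝ x (gaussMap K x) =
      (1 + s⁻¹) * (f x * inner ℝ (x - a) (gaussMap K x)) -
      s⁻¹ * (f x * inner ℝ (x - (a + s • a)) (gaussMap K x)) := by
    intro x
    simp only [inner_sub_left, inner_add_left, inner_smul_left, conj_trivial]
    field_simp
    ring
  constructor
  · simp only [hd]
    exact (i0.const_mul _).sub (i1.const_mul _)
  · have h1 : ∀ x, n * f x + fderiv ℝ f x x = (1 + s⁻¹) * (n * f x + fderiv ℝ f x (x - a)) -
        s⁻¹ * (n * f x + fderiv ℝ f x (x - (a + s • a))) := by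
      intro x
      rw [hd]
      ring
    simp only [h1, hg]
    have l0 : Integrable (fun x => n * f x + fderiv ℝ f x (x - a)) (volume.restrict K) :=
      hfi.add i0
    have l1 : Integrable (fun x => n * f x + fderiv ℝ f x (x - (a + s • a)))
      (volume.restrict K) := hfi.add i1
    rw [integral_sub (l0.const_mul _) (l1.const_mul _),
      integral_sub (j0.const_mul _) (j1.const_mul _), integral_const_mul, integral_const_mul,
      integral_const_mul, integral_const_mul, e0, e1]

end Translation

/-! ### Suprema of affine functions, recession functions and Fenchel's equality. -/

section Suprema

variable {n : ℕ} {K : Set (E n)} {f : E n → ℝ} {R : ℝ}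

/-- The supremum of the affine functions `y ↦ ⟨y, x⟩ - f x`, where `x` ranges over `K`. -/
def supAffine (K : Set (E n)) (f : E n → ℝ) (y : E n) : ℝ :=
  sSup ((fun x => inner ℝ y x - f x) '' K)

lemma supportFn_eq_supAffine (K : Set (E n)) : supportFn K = supAffine K fun _ => 0 := by
  funext y
  simp only [supportFn, supAffine, sub_zero]

lemma supAffine_le (hK : K.Nonempty) {y : E n} {b : ℝ} (h : ∀ x ∈ K, inner ℝ y x - f x ≤ b) :
    supAffine K f y ≤ b :=
  csSup_le (hK.image _) (forall_mem_image.2 h)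

lemma bddAbove_affine (hR : ∀ x ∈ K, ‖x‖ ≤ R) {C : ℝ} (hC : ∀ x ∈ K, |f x| ≤ C) (y : E n) :
    BddAbove ((fun x => inner ℝ y x - f x) '' K) := by
  refine ⟨‖y‖ * R + C, forall_mem_image.2 fun x hx => ?_⟩
  have h1 := (le_abs_self _).trans (abs_real_inner_le_norm y x)
  have h2 : ‖y‖ * ‖x‖ ≤ ‖y‖ * R := by
    have := hR x hx
    gcongr
  have h3 := (abs_le.1 (hC x hx)).1
  linarith

lemma le_supAffine (hR : ∀ x ∈ K, ‖x‖ ≤ R) {C : ℝ} (hC : ∀ x ∈ K, |f x| ≤ C) (y : E n)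
    {x : E n} (hx : x ∈ K) : inner ℝ y x - f x ≤ supAffine K f y :=
  le_csSup (bddAbove_affine hR hC y) (mem_image_of_mem _ hx)

lemma continuous_supAffine (hK : K.Nonempty) (hR : ∀ x ∈ K, ‖x‖ ≤ R) {C : ℝ}
    (hC : ∀ x ∈ K, |f x| ≤ C) : Continuous (supAffine K f) := by
  have hR0 : 0 ≤ R := (norm_nonneg _).trans (hR _ hK.some_mem)
  have h : ∀ y z, supAffine K f y ≤ supAffine K f z + R * dist y z := by
    intro y z
    refine supAffine_le hK fun x hx => ?_
    have h1 := le_supAffine hR hC z hx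
    have h2 := (le_abs_self _).trans (abs_real_inner_le_norm (y - z) x)
    have h3 : ‖y - z‖ * ‖x‖ ≤ ‖y - z‖ * R := by
      have := hR x hx
      gcongr
    rw [inner_sub_left] at h2
    rw [dist_eq_norm]
    linarith
  exact (LipschitzWith.of_le_add_mul (⟨R, hR0⟩ : ℝ≥0) h).continuous

/-- This scaling yields the homogeneity of support functions (`f = 0`) and, with `s = |ν_{n+1}|`,
the spherical function. -/
lemma supAffine_smul {s : ℝ} (hs : 0 < s) (hK : K.Nonempty) (hR : ∀ x ∈ K, ‖x‖ ≤ R) {C : ℝ}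
    (hC : ∀ x ∈ K, |f x| ≤ C) (y : E n) :
    s * supAffine K f (s⁻¹ • y) = supAffine K (fun x => s * f x) y := by
  have hC' : ∀ x ∈ K, |s * f x| ≤ s * C := fun x hx => by
    rw [abs_mul, abs_of_pos hs]
    have := hC x hx
    gcongr
  have h : ∀ x, inner ℝ (s⁻¹ • y) x = s⁻¹ * inner ℝ y x := fun x => by
    rw [inner_smul_left, conj_trivial]
  apply le_antisymm
  · rw [← le_div_iff₀' hs]
    refine supAffine_le hK fun x hx => ?_
    have h1 := le_supAffine hR hC' y hx
    rw [h, le_div_iff₀' hs, mul_sub, mul_inv_cancel_left₀ hs.ne']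
    exact h1
  · refine supAffine_le hK fun x hx => ?_
    have h1 := le_supAffine hR hC (s⁻¹ • y) hx
    rw [h] at h1
    have h2 := mul_le_mul_of_nonneg_left h1 hs.le
    rwa [mul_sub, mul_inv_cancel_left₀ hs.ne'] at h2

lemma supportFn_smul {s : ℝ} (hs : 0 ≤ s) (hK : K.Nonempty) (hR : ∀ x ∈ K, ‖x‖ ≤ R) (y : E n) :
    supportFn K (s • y) = s * supportFn K y := by
  rw [supportFn_eq_supAffine]
  rcases hs.eq_or_lt with rfl | hs
  · rw [zero_smul, zero_mul]
    apply le_antisymm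
    · exact supAffine_le hK fun x _ => by simp
    · have := le_supAffine (f := fun _ => 0) hR (C := 0) (by simp) 0 hK.some_mem
      simpa using this
  · have h := supAffine_smul (f := fun _ => 0) hs hK hR (C := 0) (by simp) (s • y)
    simp only [mul_zero] at h
    rw [← h, smul_smul, inv_mul_cancel₀ hs.ne', one_smul]

lemma le_supportFn (hR : ∀ x ∈ K, ‖x‖ ≤ R) (y : E n) {x : E n} (hx : x ∈ K) :
    inner ℝ y x ≤ supportFn K y := by
  rw [supportFn_eq_supAffine]
  simpa using le_supAffine (f := fun _ => 0) hR (C := 0) (by simp) y hx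

lemma supportFn_le (hK : K.Nonempty) {y : E n} {b : ℝ} (h : ∀ x ∈ K, inner ℝ y x ≤ b) :
    supportFn K y ≤ b := by
  rw [supportFn_eq_supAffine]
  exact supAffine_le hK fun x hx => by simpa using h x hx

/-- Both are suprema over `K` of functions that differ by at most `C`. Dividing by `t` at `t • z`
identifies the recession function. -/
lemma abs_supportFn_sub_supAffine_le (hK : K.Nonempty) (hR : ∀ x ∈ K, ‖x‖ ≤ R) {C : ℝ}
    (hC : ∀ x ∈ K, |f x| ≤ C) (y : E n) : |supportFn K y - supAffine K f y| ≤ C := by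
  rw [abs_le]
  constructor
  · have : supAffine K f y ≤ supportFn K y + C := supAffine_le hK fun x hx => by
      have h1 := le_supportFn hR y hx
      have h2 := (abs_le.1 (hC x hx)).1
      linarith
    linarith
  · have : supportFn K y ≤ supAffine K f y + C := supportFn_le hK fun x hx => by
      have h1 := le_supAffine hR hC y hx
      have h2 := (abs_le.1 (hC x hx)).2
      linarith
    linarith

lemma tendsto_supAffine_div (hK : K.Nonempty) (hR : ∀ x ∈ K, ‖x‖ ≤ R) {C : ℝ}
    (hC : ∀ x ∈ K, |f x| ≤ C) (z : E n) :
    Tendsto (fun t : ℝ => supAffine K f (t • z) / t) atTop (𝓝 (supportFn K z)) := by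
  rw [tendsto_iff_norm_sub_tendsto_zero]
  refine squeeze_zero' (Eventually.of_forall fun t => norm_nonneg _) ?_
    (tendsto_const_nhds.div_atTop tendsto_id : Tendsto (fun t : ℝ => C / t) atTop (𝓝 0))
  filter_upwards [eventually_gt_atTop 0] with t ht
  have h1 := abs_supportFn_sub_supAffine_le hK hR hC (t • z)
  rw [supportFn_smul ht.le hK hR] at h1
  have h2 : supAffine K f (t • z) / t - supportFn K z =
      -((t * supportFn K z - supAffine K f (t • z)) / t) := by
    field_simp
    ring
  rw [h2, norm_neg, norm_div, Real.norm_eq_abs, Real.norm_of_nonneg ht.le]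
  gcongr

lemma recession_supAffine (hK : K.Nonempty) (hR : ∀ x ∈ K, ‖x‖ ≤ R) {C : ℝ}
    (hC : ∀ x ∈ K, |f x| ≤ C) : recession (supAffine K f) = supportFn K := by
  funext x
  rw [recession, (tendsto_supAffine_div hK hR hC (‖x‖⁻¹ • x)).limUnder_eq,
    supportFn_smul (by positivity) hK hR]
  rcases eq_or_ne x 0 with rfl | hx
  · have := supportFn_smul le_rfl hK hR (0 : E n)
    rw [zero_smul, zero_mul] at this
    simp [this]
  · rw [mul_inv_cancel_left₀ (norm_ne_zero_iff.2 hx)]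

lemma supAffine_mem_Crec (hK : K.Nonempty) (hR : ∀ x ∈ K, ‖x‖ ≤ R) {C : ℝ}
    (hC : ∀ x ∈ K, |f x| ≤ C) : supAffine K f ∈ Crec n := by
  refine ⟨continuous_supAffine hK hR hC, fun z _ => ⟨_, tendsto_supAffine_div hK hR hC z⟩, ?_,
    C, fun x => ?_⟩
  · rw [recession_supAffine hK hR hC, supportFn_eq_supAffine]
    exact continuous_supAffine hK hR (C := 0) (by simp)
  · rw [recession_supAffine hK hR hC]
    exact abs_supportFn_sub_supAffine_le hK hR hC x

lemma supportFn_eq_inner_normal (hR : ∀ x ∈ K, ‖x‖ ≤ R) {x z : E n} (hx : x ∈ K)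
    (hz : IsOuterUnitNormal K x z) : supportFn K z = inner ℝ x z := by
  apply le_antisymm
  · refine supportFn_le ⟨x, hx⟩ fun y hy => ?_
    have := hz.2 y hy
    rw [inner_sub_left] at this
    rw [real_inner_comm]
    linarith
  · rw [real_inner_comm]
    exact le_supportFn hR z hx

/-- The subgradient inequality. -/
lemma add_fderiv_le_of_convexOn (hf : ConvexOn ℝ K f) {x y : E n} (hx : x ∈ K)
    (hd : DifferentiableAt ℝ f x) (hy : y ∈ K) : f x + fderiv ℝ f x (y - x) ≤ f y := by
  have h1 : HasDerivAt (fun t : ℝ => AffineMap.lineMap x y t) (y - x) 0 := by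
    simpa using (AffineMap.hasDerivAt_lineMap (a := x) (b := y) (x := (0 : ℝ)))
  have h2 : HasFDerivAt f (fderiv ℝ f x) (AffineMap.lineMap x y (0 : ℝ)) := by
    rw [AffineMap.lineMap_apply_zero]; exact hd.hasFDerivAt
  have h3 := (h2.comp_hasDerivAt 0 h1).hasDerivWithinAt (s := Ioi 0)
  have h4 : ConvexOn ℝ (Icc 0 1) (f ∘ fun t : ℝ => AffineMap.lineMap x y t) :=
    (hf.comp_affineMap (AffineMap.lineMap x y : ℝ →ᵃ[ℝ] E n)).subset
      (fun t ht => hf.1.lineMap_mem hx hy ht) (convex_Icc 0 1)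
  have h5 := h4.le_slope_of_hasDerivWithinAt_Ioi (left_mem_Icc.2 zero_le_one)
    (right_mem_Icc.2 zero_le_one) one_pos h3
  rw [slope_def_field] at h5
  simp only [Function.comp_apply, AffineMap.lineMap_apply_one, AffineMap.lineMap_apply_zero,
    sub_zero, div_one] at h5
  linarith

/-- Fenchel's equality. -/
lemma supAffine_gradient (hf : ConvexOn ℝ K f) (hR : ∀ x ∈ K, ‖x‖ ≤ R) {C : ℝ}
    (hC : ∀ x ∈ K, |f x| ≤ C) {x : E n} (hx : x ∈ K) (hd : DifferentiableAt ℝ f x) :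
    supAffine K f (gradient f x) = fderiv ℝ f x x - f x := by
  have hg : ∀ y, inner ℝ (gradient f x) y = fderiv ℝ f x y := fun y => by
    rw [gradient, InnerProductSpace.toDual_symm_apply]
  apply le_antisymm
  · refine supAffine_le ⟨x, hx⟩ fun y hy => ?_
    have h1 := add_fderiv_le_of_convexOn hf hx hd hy
    rw [map_sub] at h1
    rw [hg]
    linarith
  · rw [← hg]
    exact le_supAffine hR hC _ hx

end Suprema

/-! ### Functions in `Conv_0`, their conjugates and the body `K^u`. -/

section Conv0

variable {n : ℕ} {u : E n → EReal}

lemma IsConv0.coe_toReal (hu : IsConv0 u) {x : E n} (hx : x ∈ dom u) :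
    ((u x).toReal : EReal) = u x :=
  EReal.coe_toReal (ne_of_lt hx) (hu.ne_bot x)

lemma IsConv0.combo_le (hu : IsConv0 u) {x y : E n} (hx : x ∈ dom u) (hy : y ∈ dom u) {a b : ℝ}
    (ha : 0 ≤ a) (hb : 0 ≤ b) (hab : a + b = 1) :
    u (a • x + b • y) ≤ ((a * (u x).toReal + b * (u y).toReal : ℝ) : EReal) := by
  have h1 : (WithLp.toLp 2 (x, (u x).toReal) : E1 n) ∈ epi u := (hu.coe_toReal hx).ge
  have h2 : (WithLp.toLp 2 (y, (u y).toReal) : E1 n) ∈ epi u := (hu.coe_toReal hy).ge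
  exact hu.convex h1 h2 ha hb hab

lemma IsConv0.convexOn (hu : IsConv0 u) : ConvexOn ℝ (dom u) fun x => (u x).toReal := by
  have hconv : Convex ℝ (dom u) := fun x hx y hy a b ha hb hab =>
    (hu.combo_le hx hy ha hb hab).trans_lt (EReal.coe_lt_top _)
  refine ⟨hconv, fun x hx y hy a b ha hb hab => ?_⟩
  have h := hu.combo_le hx hy ha hb hab
  rw [← hu.coe_toReal (hconv hx hy ha hb hab), EReal.coe_le_coe_iff] at h
  exact h

lemma IsConv0.toReal_nonpos (hu : IsConv0 u) {x : E n} (hx : x ∈ dom u) : (u x).toReal ≤ 0 := by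
  have h := hu.nonpos x hx
  rw [← hu.coe_toReal hx] at h
  exact_mod_cast h

/-- Lower semicontinuity gives a minimum on the compact domain, and `0` is an upper bound. -/
lemma IsConv0.exists_bound (hu : IsConv0 u) : ∃ C, ∀ x ∈ dom u, |(u x).toReal| ≤ C := by
  obtain ⟨x₀, hx₀, hmin⟩ := (hu.lsc.lowerSemicontinuousOn (dom u)).exists_isMinOn hu.proper
    hu.compact_dom
  refine ⟨-(u x₀).toReal, fun x hx => ?_⟩
  have h : u x₀ ≤ u x := hmin hx
  rw [← hu.coe_toReal hx, ← hu.coe_toReal hx₀, EReal.coe_le_coe_iff] at h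
  rw [abs_of_nonpos (hu.toReal_nonpos hx)]
  linarith

lemma IsConv0.measurable_toReal (hu : IsConv0 u) : Measurable fun x => (u x).toReal :=
  hu.lsc.measurable.ereal_toReal

lemma IsConv0.lowerSemicontinuousOn_toReal (hu : IsConv0 u) :
    LowerSemicontinuousOn (fun x => (u x).toReal) (dom u) := by
  intro x hx c hc
  have h1 : (c : EReal) < u x := by
    rw [← hu.coe_toReal hx]
    exact_mod_cast hc
  filter_upwards [(hu.lsc x c h1).filter_mono nhdsWithin_le_nhds, self_mem_nhdsWithin]
    with y hy hyd
  rw [← hu.coe_toReal hyd] at hy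
  exact_mod_cast hy

/-- The convex conjugate is a supremum of affine functions over the domain. -/
lemma IsConv0.coe_supAffine (hu : IsConv0 u) (y : E n) :
    (supAffine (dom u) (fun x => (u x).toReal) y : EReal) = conj u y := by
  obtain ⟨C, hC⟩ := hu.exists_bound
  obtain ⟨R, hR⟩ := hu.compact_dom.isBounded.exists_norm_le
  have hle : ∀ x ∈ dom u, ((inner ℝ y x - (u x).toReal : ℝ) : EReal) ≤ conj u y := by
    intro x hx
    rw [EReal.coe_sub, hu.coe_toReal hx, real_inner_comm]
    exact le_iSup (fun x : E n => ((inner ℝ x y : ℝ) : EReal) - u x) x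
  apply le_antisymm
  · induction hc : conj u y with
    | bot =>
      obtain ⟨x, hx⟩ := hu.proper
      have := hle x hx
      rw [hc] at this
      exact absurd this (not_le.2 (EReal.bot_lt_coe _))
    | top => exact le_top
    | coe c =>
      rw [EReal.coe_le_coe_iff]
      refine supAffine_le hu.proper fun x hx => ?_
      have := hle x hx
      rw [hc] at this
      exact_mod_cast this
  · refine iSup_le fun x => ?_
    by_cases hx : x ∈ dom u
    · rw [← hu.coe_toReal hx, ← EReal.coe_sub, EReal.coe_le_coe_iff, real_inner_comm]
      exact le_supAffine hR hC y hx
    · have : u x = ⊤ := not_lt_top_iff.1 hx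
      rw [this, EReal.sub_top]
      exact bot_le

lemma IsConv0.mem_body_iff (hu : IsConv0 u) (p : E1 n) :
    p ∈ body u ↔ p.fst ∈ dom u ∧ |p.snd| ≤ -(u p.fst).toReal := by
  have h1 : p ∈ reflH '' epi u ↔ u p.fst ≤ ((-p.snd : ℝ) : EReal) := by
    constructor
    · rintro ⟨q, hq, rfl⟩
      have hq' : u q.fst ≤ (q.snd : EReal) := hq
      simpa [reflH] using hq'
    · intro h
      refine ⟨reflH p, h, ?_⟩
      simp [reflH]
      rfl
  rw [body, mem_inter_iff, h1]
  constructor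
  · rintro ⟨h2, h3⟩
    have hd : p.fst ∈ dom u := lt_of_le_of_lt h3 (EReal.coe_lt_top _)
    have h2' : u p.fst ≤ (p.snd : EReal) := h2
    rw [← hu.coe_toReal hd, EReal.coe_le_coe_iff] at h2' h3
    exact ⟨hd, abs_le.2 ⟨by linarith, by linarith⟩⟩
  · rintro ⟨hd, h⟩
    obtain ⟨h2, h3⟩ := abs_le.1 h
    refine ⟨?_, ?_⟩
    · show u p.fst ≤ (p.snd : EReal)
      rw [← hu.coe_toReal hd, EReal.coe_le_coe_iff]
      linarith
    · rw [← hu.coe_toReal hd, EReal.coe_le_coe_iff]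
      linarith

/-- Over `x` the body is the segment from `u(x)` to `-u(x)`, on which `ν` is maximal at an endpoint
chosen by the sign of `ν_{n+1}`. -/
lemma IsConv0.supportFn_body (hu : IsConv0 u) (ν : E1 n) :
    supportFn (body u) ν = supAffine (dom u) (fun x => |ν.snd| * (u x).toReal) ν.fst := by
  obtain ⟨C, hC⟩ := hu.exists_bound
  obtain ⟨R, hR⟩ := hu.compact_dom.isBounded.exists_norm_le
  have hC' : ∀ x ∈ dom u, |(|ν.snd| * (u x).toReal)| ≤ |ν.snd| * C := fun x hx => by
    rw [abs_mul, abs_abs]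
    have := hC x hx
    gcongr
  have hinner : ∀ p : E1 n, inner ℝ ν p = inner ℝ ν.fst p.fst + ν.snd * p.snd := fun p => by
    rw [WithLp.prod_inner_apply]
    simp [mul_comm]
  have hub : ∀ p ∈ body u, inner ℝ ν p ≤
      supAffine (dom u) (fun x => |ν.snd| * (u x).toReal) ν.fst := by
    intro p hp
    obtain ⟨hd, h⟩ := (hu.mem_body_iff p).1 hp
    have h1 := le_supAffine hR hC' ν.fst hd
    have h2 : ν.snd * p.snd ≤ |ν.snd| * -(u p.fst).toReal := by
      refine (le_abs_self _).trans ?_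
      rw [abs_mul]
      gcongr
    rw [hinner]
    linarith
  have hmem : ∀ x ∈ dom u, ∃ p ∈ body u,
      inner ℝ ν p = inner ℝ ν.fst x - |ν.snd| * (u x).toReal := by
    intro x hx
    have h0 := hu.toReal_nonpos hx
    rcases le_total 0 ν.snd with hs | hs
    · refine ⟨WithLp.toLp 2 (x, -(u x).toReal), (hu.mem_body_iff _).2 ⟨hx, ?_⟩, ?_⟩
      · exact (abs_of_nonneg (neg_nonneg.2 h0)).le
      · rw [hinner, abs_of_nonneg hs]
        show inner ℝ ν.fst x + ν.snd * -(u x).toReal = _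
        ring
    · refine ⟨WithLp.toLp 2 (x, (u x).toReal), (hu.mem_body_iff _).2 ⟨hx, ?_⟩, ?_⟩
      · exact (abs_of_nonpos h0).le
      · rw [hinner, abs_of_nonpos hs]
        show inner ℝ ν.fst x + ν.snd * (u x).toReal = _
        ring
  apply le_antisymm
  · obtain ⟨x, hx⟩ := hu.proper
    obtain ⟨p, hp, -⟩ := hmem x hx
    exact csSup_le (Set.Nonempty.image _ ⟨p, hp⟩) (forall_mem_image.2 hub)
  · refine supAffine_le hu.proper fun x hx => ?_
    obtain ⟨p, hp, heq⟩ := hmem x hx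
    rw [← heq]
    exact le_csSup ⟨_, forall_mem_image.2 hub⟩ (mem_image_of_mem _ hp)

lemma gnom_reflH (ν : E1 n) : gnom (reflH ν) = gnom ν := by
  show |-ν.snd|⁻¹ • ν.fst = |ν.snd|⁻¹ • ν.fst
  rw [abs_neg]

lemma sqrt_one_add_norm_gnom_sq {ν : E1 n} (hν : ‖ν‖ = 1) (h0 : ν.snd ≠ 0) :
    √(1 + ‖gnom ν‖ ^ 2) = |ν.snd|⁻¹ := by
  have h1 := WithLp.prod_norm_sq_eq_of_L2 ν
  rw [hν, Real.norm_eq_abs, sq_abs] at h1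
  rw [Real.sqrt_eq_iff_mul_self_eq (by positivity) (by positivity), gnom, norm_smul, norm_inv,
    Real.norm_eq_abs, abs_abs, mul_pow, inv_pow, sq_abs, ← mul_inv, abs_mul_abs_self]
  field_simp
  linarith

/-- The spherical function of the conjugate of `u` is the support function of `K^u`. -/
lemma IsConv0.tildeFn_eq (hu : IsConv0 u) {ν : E1 n} (hν : ‖ν‖ = 1) :
    tildeFn (supAffine (dom u) fun x => (u x).toReal) ν = supportFn (body u) ν := by
  obtain ⟨C, hC⟩ := hu.exists_bound
  obtain ⟨R, hR⟩ := hu.compact_dom.isBounded.exists_norm_le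
  rw [hu.supportFn_body]
  have hne : ν.snd ≠ 0 → supAffine (dom u) (fun x => (u x).toReal) (gnom ν) /
      √(1 + ‖gnom ν‖ ^ 2) = supAffine (dom u) (fun x => |ν.snd| * (u x).toReal) ν.fst := by
    intro h
    rw [sqrt_one_add_norm_gnom_sq hν h, div_inv_eq_mul, mul_comm, gnom,
      supAffine_smul (abs_pos.2 h) hu.proper hR hC]
  unfold tildeFn
  split_ifs with h1 h2
  · exact hne h1.ne
  · rw [recession_supAffine hu.proper hR hC, supportFn_eq_supAffine, h2]
    simp
  · rw [gnom_reflH]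
    exact hne h2

end Conv0

/-! ### The integrals for a domain with interior points. -/

section FullDim

variable {n : ℕ} {K : Set (E n)} {f : E n → ℝ} {C R : ℝ}

/-- Fenchel's equality holds almost everywhere and turns the integrand into `⟨x, ∇f⟩ - f`, to which
the divergence theorem applies. -/
lemma integral_supAffine_gradient (hn : 1 ≤ n) (hc : IsCompact K)
    (hint : (interior K).Nonempty) (hfm : Measurable f) (hf : ConvexOn ℝ K f)
    (hlsc : LowerSemicontinuousOn f K) (hR : ∀ x ∈ K, ‖x‖ ≤ R) (hC : ∀ x ∈ K, |f x| ≤ C) :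
    IntegrableOn (fun x => supAffine K f (gradient f x)) K ∧
    ∫ x in K, supAffine K f (gradient f x) =
      (∫ x in frontier K, f x * inner ℝ x (gaussMap K x) ∂μHE[n - 1]) -
        (n + 1) * ∫ x in K, f x := by
  obtain ⟨i1, e1⟩ := integral_divergence hn hc hf.1 hint hfm hf hlsc hC
  have hfin : IsFiniteMeasure (volume.restrict K) := ⟨by simpa using hc.measure_lt_top⟩
  have hfi : IntegrableOn f K := Integrable.of_bound hfm.aestronglyMeasurable C
    ((ae_restrict_mem hc.isClosed.measurableSet).mono fun x hx => hC x hx)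
  have hae : (fun x => supAffine K f (gradient f x)) =ᵐ[volume.restrict K]
      fun x => fderiv ℝ f x x - f x := by
    filter_upwards [ae_differentiableAt_of_convexOn hf] with x hx
    exact supAffine_gradient hf hR hC (interior_subset hx.1) hx.2
  refine ⟨(i1.sub hfi).congr hae.symm, ?_⟩
  rw [integral_congr_ae hae, integral_sub i1 hfi, ← e1, integral_add (hfi.const_mul _) i1,
    integral_const_mul]
  ring

lemma ae_mul_supportFn_gaussMap (hc : IsCompact K) (hK : Convex ℝ K)
    (hint : (interior K).Nonempty) (hR : ∀ x ∈ K, ‖x‖ ≤ R) (hf0 : ∀ x ∈ K, f x ≤ 0) :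
    (fun x => |f x| * supportFn K (gaussMap K x)) =ᵐ[μHE[n - 1].restrict (frontier K)]
      fun x => -(f x * inner ℝ x (gaussMap K x)) := by
  filter_upwards [ae_frontier_normal_eq_gaussMap hc.isClosed hK hint,
    ae_restrict_mem isClosed_frontier.measurableSet] with x hx hxf
  have hxK := hc.isClosed.frontier_subset hxf
  rw [supportFn_eq_inner_normal hR hxK hx.1, abs_of_nonpos (hf0 x hxK)]
  ring

end FullDim

/-! ### Domains contained in a hyperplane. -/

section Degenerate

variable {n : ℕ} {K : Set (E n)}

lemma exists_hyperplane_normal (hne : K.Nonempty) (h : affineSpan ℝ K ≠ ⊤) :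
    ∃ z : E n, ‖z‖ = 1 ∧ ∃ c : ℝ, ∀ y ∈ K, inner ℝ y z = c := by
  obtain ⟨p, hp⟩ := hne
  have hp' : p ∈ affineSpan ℝ K := subset_affineSpan ℝ K hp
  have hdir : (affineSpan ℝ K).direction ≠ ⊤ := fun h' =>
    h ((AffineSubspace.direction_eq_top_iff_of_nonempty ⟨p, hp'⟩).1 h')
  obtain ⟨w, hw, hw0⟩ := Submodule.exists_mem_ne_zero_of_ne_bot
    (mt Submodule.orthogonal_eq_bot_iff.1 hdir)
  refine ⟨‖w‖⁻¹ • w, ?_, inner ℝ p (‖w‖⁻¹ • w), fun y hy => ?_⟩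
  · rw [norm_smul, norm_inv, norm_norm, inv_mul_cancel₀ (norm_ne_zero_iff.2 hw0)]
  · have h1 : y - p ∈ (affineSpan ℝ K).direction :=
      AffineSubspace.vsub_mem_direction (subset_affineSpan ℝ K hy) hp'
    have h2 := (Submodule.mem_orthogonal _ w).1 hw _ h1
    rw [← sub_eq_zero, ← inner_sub_left, inner_smul_right, h2, mul_zero]

lemma hyperplaneNormal_spec (hne : K.Nonempty) (h : affineSpan ℝ K ≠ ⊤) :
    ‖hyperplaneNormal K‖ = 1 ∧ ∃ c : ℝ, ∀ y ∈ K, inner ℝ y (hyperplaneNormal K) = c := by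
  have hex := exists_hyperplane_normal hne h
  rw [hyperplaneNormal, dif_pos hex]
  exact hex.choose_spec

lemma isOuterUnitNormal_of_inner_eq {z x : E n} {c : ℝ} (hz : ‖z‖ = 1)
    (hc : ∀ y ∈ K, inner ℝ y z = c) (hx : x ∈ K) : IsOuterUnitNormal K x z :=
  ⟨hz, fun y hy => by rw [inner_sub_left, hc y hy, hc x hx, sub_self]⟩

/-- Both `z` and `-z` are normals, so uniqueness fails and the default value `0` applies. -/
lemma gaussMap_eq_zero_of_inner_eq {z x : E n} {c : ℝ} (hz : ‖z‖ = 1)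
    (hc : ∀ y ∈ K, inner ℝ y z = c) (hx : x ∈ K) : gaussMap K x = 0 := by
  refine dif_neg fun hex => ?_
  have h1 := isOuterUnitNormal_of_inner_eq hz hc hx
  have h2 : IsOuterUnitNormal K x (-z) := isOuterUnitNormal_of_inner_eq (c := -c)
    (by rwa [norm_neg]) (fun y hy => by rw [inner_neg_right, hc y hy]) hx
  have h3 := hex.unique h1 h2
  have h4 : (2 : ℝ) • z = 0 := by
    rw [two_smul]
    nth_rewrite 1 [h3]
    exact neg_add_cancel z
  rw [(smul_eq_zero.1 h4).resolve_left two_ne_zero, norm_zero] at hz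
  exact zero_ne_one hz

lemma supportFn_add_supportFn_neg {R : ℝ} (hR : ∀ x ∈ K, ‖x‖ ≤ R) (hne : K.Nonempty) {z : E n}
    {c : ℝ} (hz : ‖z‖ = 1) (hc : ∀ y ∈ K, inner ℝ y z = c) :
    supportFn K z + supportFn K (-z) = 0 := by
  obtain ⟨x, hx⟩ := hne
  have h1 := isOuterUnitNormal_of_inner_eq hz hc hx
  have h2 : IsOuterUnitNormal K x (-z) := isOuterUnitNormal_of_inner_eq (c := -c)
    (by rwa [norm_neg]) (fun y hy => by rw [inner_neg_right, hc y hy]) hx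
  rw [supportFn_eq_inner_normal hR hx h1, supportFn_eq_inner_normal hR hx h2, inner_neg_right,
    add_neg_cancel]

end Degenerate

end ConvFun

end

/-! ### Assembly of the full-dimensional and the degenerate case. -/

theorem proposition4p5 (n : ℕ) (hn : 1 ≤ n) (u : ConvFun.E n → EReal) (hu : ConvFun.IsConv0 u) :
    ∃ φ : ConvFun.E n → ℝ,
      -- `φ = u^*`, which in particular is finite everywhere
      (∀ y, (φ y : EReal) = ConvFun.conj u y) ∧
      φ ∈ ConvFun.Crec n ∧
      ConvFun.recession φ = ConvFun.supportFn (ConvFun.dom u) ∧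
      (∀ ν : ConvFun.E1 n, ‖ν‖ = 1 →
        ConvFun.tildeFn φ ν = ConvFun.supportFn (ConvFun.body u) ν) ∧
      -- the integrals in `Z_φ(u)` and in `V̄_{n+1}(u)` exist
      IntegrableOn (fun x => φ (ConvFun.grad u x)) (ConvFun.dom u) ∧
      IntegrableOn (fun x => |(u x).toReal|) (frontier (ConvFun.dom u)) μHE[n - 1] ∧
      IntegrableOn (fun x => |(u x).toReal| *
        ConvFun.recession φ (ConvFun.gaussMap (ConvFun.dom u) x))
        (frontier (ConvFun.dom u)) μHE[n - 1] ∧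
      IntegrableOn (fun x => |(u x).toReal|) (ConvFun.dom u) ∧
      1 / ((n : ℝ) + 1) * ConvFun.Z φ u = ConvFun.Vbar u := by
  open ConvFun in
  obtain ⟨C, hC⟩ := hu.exists_bound
  obtain ⟨R, hR⟩ := hu.compact_dom.isBounded.exists_norm_le
  have hc := hu.compact_dom
  have hne := hu.proper
  have hf := hu.convexOn
  have hfm := hu.measurable_toReal
  have hlsc := hu.lowerSemicontinuousOn_toReal
  have hneg : ∀ x ∈ dom u, (u x).toReal ≤ 0 := fun x hx => hu.toReal_nonpos hx
  have hrec : recession (supAffine (dom u) fun x => (u x).toReal) = supportFn (dom u) :=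
    recession_supAffine hne hR hC
  have hvol : IsFiniteMeasure (volume.restrict (dom u)) := ⟨by simpa using hc.measure_lt_top⟩
  have hV : IntegrableOn (fun x => |(u x).toReal|) (dom u) :=
    Integrable.of_bound (hfm.abs).aestronglyMeasurable C
      ((ae_restrict_mem hc.isClosed.measurableSet).mono fun x hx => by
        rw [Real.norm_eq_abs, abs_abs]; exact hC x hx)
  have hbd : ∀ h : ∀ x ∈ frontier (dom u), ∃ z, IsOuterUnitNormal (dom u) x z,
      IntegrableOn (fun x => |(u x).toReal|) (frontier (dom u)) μHE[n - 1] := fun h => by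
    have : IsFiniteMeasure (μHE[n - 1].restrict (frontier (dom u))) :=
      ⟨by simpa using measure_frontier_lt_top hc h⟩
    exact Integrable.of_bound (hfm.abs).aestronglyMeasurable C
      ((ae_restrict_mem isClosed_frontier.measurableSet).mono fun x hx => by
        rw [Real.norm_eq_abs, abs_abs]; exact hC x (hc.isClosed.frontier_subset hx))
  have hn1 : (n : ℝ) + 1 ≠ 0 := by positivity
  refine ⟨supAffine (dom u) fun x => (u x).toReal, hu.coe_supAffine,
    supAffine_mem_Crec hne hR hC, hrec, fun ν hν => hu.tildeFn_eq hν, ?_⟩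
  by_cases hspan : affineSpan ℝ (dom u) = ⊤
  · have hint : (interior (dom u)).Nonempty := hf.1.interior_nonempty_iff_affineSpan_eq_top.2 hspan
    obtain ⟨i1, e1⟩ := integral_supAffine_gradient hn hc hint hfm hf hlsc hR hC
    have hae := ae_mul_supportFn_gaussMap hc hf.1 hint hR hneg
    have i2 : IntegrableOn (fun x => (u x).toReal * inner ℝ x (gaussMap (dom u) x))
        (frontier (dom u)) μHE[n - 1] := by
      simpa using integrableOn_frontier_mul_inner hc hf.1 hint hfm hC 0
    refine ⟨i1, hbd fun x hx => exists_normal_of_mem_frontier hf.1 hint hx, ?_, hV, ?_⟩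
    · rw [hrec]
      exact i2.neg.congr hae.symm
    · have hZ : Z (supAffine (dom u) fun x => (u x).toReal) u =
          (∫ x in dom u, supAffine (dom u) (fun x => (u x).toReal)
            (gradient (fun y => (u y).toReal) x)) +
          ∫ x in frontier (dom u), |(u x).toReal| * supportFn (dom u) (gaussMap (dom u) x)
            ∂μHE[n - 1] := by
        rw [Z, boundaryTerm, if_pos hspan, hrec]
        rfl
      have hVb : Vbar u = -∫ x in dom u, (u x).toReal := by
        rw [Vbar, ← integral_neg]
        exact setIntegral_congr_fun hc.isClosed.measurableSet fun x hx =>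
          abs_of_nonpos (hneg x hx)
      rw [hZ, e1, integral_congr_ae hae, integral_neg, hVb]
      field_simp
      ring
  · obtain ⟨hz, c, hzc⟩ := hyperplaneNormal_spec hne hspan
    have hnull : volume (dom u) = 0 := measure_mono_null (subset_affineSpan ℝ (dom u))
      (Measure.addHaar_affineSubspace _ _ hspan)
    have hres : volume.restrict (dom u) = 0 := Measure.restrict_eq_zero.2 hnull
    -- Every point of the domain has the hyperplane normal as outer normal, so the boundary still
    -- has finite measure.
    refine ⟨?_, hbd fun x hx => ⟨_, isOuterUnitNormal_of_inner_eq hz hzc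
      (hc.isClosed.frontier_subset hx)⟩, ?_, hV, ?_⟩
    · rw [IntegrableOn, hres]
      exact integrable_zero_measure
    -- The Gauss map takes its default value `0` here and the recession function vanishes at `0`, so
    -- the integrand is zero.
    · refine IntegrableOn.congr_fun (f := fun _ => (0 : ℝ)) (by simp [IntegrableOn])
        (fun x hx => ?_) isClosed_frontier.measurableSet
      simp only [gaussMap_eq_zero_of_inner_eq hz hzc (hc.isClosed.frontier_subset hx)]
      simp [recession]
    · rw [Z, boundaryTerm, if_neg hspan, hrec, supportFn_add_supportFn_neg hR hne hz hzc, Vbar,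
        hres]
      simp
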